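/- Let $(R,\mathfrak m)$ be a commutative Artinian local ring and let $n\ge 0$ be an integer. All modules are finitely generated $R$-modules. A module $C$ is semidualizing if the homothety map $R\to\mathrm{Hom}_R(C,C)$ is an isomorphism and $\mathrm{Ext}^i_R(C,C)=0$ for all $i\ge 1$. The set of isomorphism classes $[C]$ of semidualizing modules is $\mathfrak G_0(R)$. For semidualizing $C$, a module $M$ is totally $C$-reflexive if the biduality map $M\to\mathrm{Hom}_R(\mathrm{Hom}_R(M,C),C)$ is an isomorphism and $\mathrm{Ext}^i_R(M,C)=0=\mathrm{Ext}^i_R(\mathrm{Hom}_R(M,C),C)$ for all $i\ge1$. Write $[C]\vartriangleleft[B]$ if $[C]\ne[B]$ and $B$ is totally $C$-reflexive. A chain of length $n$ in $\mathfrak G_0(R)$ is a sequence $[C_n]\vartriangleleft\cdots\vartriangleleft[C_1]\vartriangleleft[C_0]$ in $\mathfrak G_0(R)$ whose members are pairwise distinct. It is suitable if $C_0\cong R$ and, for all sequences $1\le i_1<\cdots<i_j\le n$ with $j\ge0$ and all integers $0\le t\le n$ with $i_j\le t$ (no condition on $t$ beyond $0\le t\le n$ if $j=0$), the module obtained from $C_0$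 by applying successively $\mathrm{Hom}_R(-,C_{i_1}),\dots,\mathrm{Hom}_R(-,C_{i_j})$ is totally $C_t$-reflexive. Modules $K_1,\dots,K_n$ are strongly $\mathrm{Tor}$-independent if for every subset $\Lambda\subseteq\{1,\dots,n\}$ the derived tensor product $\bigotimes^{\mathbf L}_{i\in\Lambda}K_i$ over $R$ has amplitude $0$, i.e. nonzero homology in exactly one degree. The ring $R$ is $SD(n)$-full if $\mathfrak m^{n+1}=0$ and there are strongly $\mathrm{Tor}$-independent non-free semidualizing modules $K_1,\dots,K_n$ such that $\bigotimes_{i\in\Lambda}K_i$ is semidualizing for every subset $\Lambda\subseteq\{1,\dots,n\}$ (empty tensor products are $R$). **Theorem.** $R$ is $SD(n)$-full if and only if $\mathfrak m^{n+1}=0$ and there is a suitable chain of length $n$ in $\mathfrak G_0(R)$. -/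

import Mathlib

open CategoryTheory MonoidalCategory

universe u v w

section Semidualizing

variable {R : Type u} [CommRing R]

/-- A semidualizing module: finitely generated, the homothety map `R → Hom_R(C, C)` is an
isomorphism, and `Ext^i_R(C, C) = 0` for all `i ≥ 1`. -/
structure IsSemidualizing (C : ModuleCat.{u} R) : Prop where
  finite : Module.Finite R C
  homothety_bijective : Function.Bijective (LinearMap.lsmul R C)
  ext_eq_zero : ∀ i : ℕ, 1 ≤ i → Subsingleton (Abelian.Ext C C i)

/-- The dual `M^{†_C} = Hom_R(M, C)`. -/
abbrev dagger (C M : ModuleCat.{u} R) : ModuleCat.{u} R :=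
  ModuleCat.of R (M →ₗ[R] C)

/-- `M` is totally `C`-reflexive (used for semidualizing `C`): `M` is finitely generated, the
biduality map `M → Hom_R(Hom_R(M, C), C)`, `m ↦ (f ↦ f m)`, is an isomorphism, and
`Ext^i_R(M, C) = 0 = Ext^i_R(Hom_R(M, C), C)` for all `i ≥ 1`. -/
structure IsTotallyReflexive (C M : ModuleCat.{u} R) : Prop where
  finite : Module.Finite R M
  biduality_bijective :
    Function.Bijective (LinearMap.applyₗ : M →ₗ[R] (M →ₗ[R] C) →ₗ[R] C)
  ext_eq_zero : ∀ i : ℕ, 1 ≤ i → Subsingleton (Abelian.Ext M C i)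
  ext_dual_eq_zero : ∀ i : ℕ, 1 ≤ i → Subsingleton (Abelian.Ext (dagger C M) C i)

/-- `C 0, …, C n` represent a chain `[C n] ◁ ⋯ ◁ [C 1] ◁ [C 0]` of length `n` in the set of
isomorphism classes of semidualizing modules: all `C i` are semidualizing, each `C i` is totally
`C (i + 1)`-reflexive, and the isomorphism classes `[C 0], …, [C n]` are pairwise distinct. -/
structure IsSemidualizingChain {n : ℕ} (C : Fin (n + 1) → ModuleCat.{u} R) : Prop where
  semidualizing : ∀ i, IsSemidualizing (C i)
  reflexive : ∀ i : Fin n, IsTotallyReflexive (C i.succ) (C i.castSucc)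
  distinct : ∀ i j, i ≠ j → IsEmpty (C i ≅ C j)

/-- For `s = {i_1 < ⋯ < i_j} ⊆ {1, …, n}` (the element `i : Fin n` stands for the integer `i + 1`),
the iterated dual `C_s = (⋯((C 0)^{†_{C i_1}})^{†_{C i_2}}⋯)^{†_{C i_j}}`, with `C_∅ = C 0`. -/
def iteratedDual {n : ℕ} (C : Fin (n + 1) → ModuleCat.{u} R) (s : Finset (Fin n)) :
    ModuleCat.{u} R :=
  (s.sort (· ≤ ·)).foldl (fun M i => dagger (C i.succ) M) (C 0)

/-- A suitable chain of length `n`: a chain of length `n` with `[C 0] = [R]` such that for each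
`s = {i_1 < ⋯ < i_j} ⊆ {1, …, n}` and each `t ≤ n` with `i_j ≤ t` (that is, with every element of
`s` at most `t`) the module `C_s` is totally `C t`-reflexive. -/
structure IsSuitableChain {n : ℕ} (C : Fin (n + 1) → ModuleCat.{u} R) : Prop
    extends IsSemidualizingChain C where
  zero_iso : Nonempty (C 0 ≅ ModuleCat.of R R)
  suitable : ∀ (s : Finset (Fin n)) (t : Fin (n + 1)), (∀ i ∈ s, i.succ ≤ t) →
    IsTotallyReflexive (C t) (iteratedDual C s)

end Semidualizing

section TorIndependence

/-- The iterated tensor product `X_1 ⊗ (X_2 ⊗ (⋯ ⊗ 𝟙))` of a list of objects of a monoidal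
category. -/
def tensorList {A : Type v} [Category.{w} A] [MonoidalCategory A] (L : List A) : A :=
  L.foldr (fun X Y => X ⊗ Y) (𝟙_ A)

variable {R : Type u} [CommRing R]

/-- The tensor product over `R` of the modules `K i`, `i ∈ s`, in increasing order of indices;
the empty tensor product is `R`. -/
noncomputable def tensorOver {n : ℕ} (K : Fin n → ModuleCat.{u} R) (s : Finset (Fin n)) :
    ModuleCat.{u} R :=
  tensorList ((s.sort (· ≤ ·)).map K)

/-- The derived tensor product `⊗^L_{i ∈ s} K i`, represented by the total tensor product of
projective resolutions of the modules `K i`, `i ∈ s`, in increasing order of indices. The empty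
derived tensor product is `R` in degree `0`. -/
noncomputable def derivedTensorOver {n : ℕ} (K : Fin n → ModuleCat.{u} R) (s : Finset (Fin n)) :
    ChainComplex (ModuleCat.{u} R) ℕ :=
  tensorList ((s.sort (· ≤ ·)).map fun i => (projectiveResolution (K i)).complex)

/-- `amp X = sup {i | H_i(X) ≠ 0} - inf {i | H_i(X) ≠ 0}` is `0`: there is exactly one degree in
which the homology of `X` is nonzero. -/
def AmpEqZero (X : ChainComplex (ModuleCat.{u} R) ℕ) : Prop :=
  ∃! i : ℕ, ¬ Limits.IsZero (X.homology i)

/-- The modules `K i` are strongly Tor-independent: `amp (⊗^L_{i ∈ s} K i) = 0` for each subset `s`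
of the index set. -/
def StronglyTorIndependent {n : ℕ} (K : Fin n → ModuleCat.{u} R) : Prop :=
  ∀ s : Finset (Fin n), AmpEqZero (derivedTensorOver K s)

end TorIndependence

/-- A local ring (in the application: Artinian) is `SD(n)`-full if `𝔪^(n+1) = 0` and there are
strongly Tor-independent non-free semidualizing modules `K_1, …, K_n` such that `⊗_{i ∈ s} K_i` is
semidualizing for each `s ⊆ {1, …, n}`. -/
def IsSDFull (R : Type u) [CommRing R] [IsLocalRing R] (n : ℕ) : Prop :=
  IsLocalRing.maximalIdeal R ^ (n + 1) = ⊥ ∧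
    ∃ K : Fin n → ModuleCat.{u} R,
      (∀ i, IsSemidualizing (K i)) ∧
      (∀ i, ¬ Module.Free R (K i)) ∧
      StronglyTorIndependent K ∧
      ∀ s : Finset (Fin n), IsSemidualizing (tensorOver K s)

/-!
A strongly Tor-independent family `K_1, …, K_n` and a suitable chain `C_0, …, C_n` determine each
other by `C_t = K_1 ⊗ ⋯ ⊗ K_t` and `K_i = Hom(C_{i-1}, C_i)`. Write `K_s` for the tensor product of
the `K_i` with `i ∈ s`.

From families to chains: for `s ⊆ t` the module `K_t` is the derived tensor product of the
semidualizing modules `K_s` and `K_{t \ s}`. Hence `K_s` is totally `K_t`-reflexive with dual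
`K_{t \ s}` (`IsTotallyReflexive.of_tensor`, `tensorAdjoint_bijective`). So dualizing with respect
to `C_i` complements the index set in `{1, …, i}`, and every iterated dual of the chain is some
`K_r` (`exists_iteratedDual_tensorOver`).

From chains to families: if `A` is semidualizing and totally `C`-reflexive, then
`A ⊗ᴸ Hom(A, C) = C` (`IsTotallyReflexive.evalDagger_bijective`,
`IsTotallyReflexive.torIndependent`), and `Hom(A, C)` is the only finitely generated module `Y` with
`A ⊗ Y ≅ C` (`IsTotallyReflexive.nonempty_linearEquiv_dagger`). By induction on `t`, each `K_s` with
`s ⊆ {1, …, t}` is an iterated dual of the chain, and its dual with respect to `C_t` is the `K_c` of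
the complementary set `c` (`IsSuitableChain.tensorOver_chainHom`). Comparing
`C_i = K_c ⊗ᴸ (K_s ⊗ K_i)` with `C_i = (K_c ⊗ᴸ K_s) ⊗ᴸ K_i` and cancelling `K_c` shows that `K_s`
and `K_i` are Tor-independent (`IsSuitableChain.torIndependent_tensorOver_chainHom`).

Two results on modules over an Artinian local ring carry the argument. A Tor-independent finitely
generated factor `A ≠ 0` can be cancelled from the vanishing of `Ext^i(A ⊗ B, N)`
(`ExtVanishes.of_tensor`), since there are nonzero maps from `A` to every nonzero module. And
vanishing of Ext groups into a nonzero module detects Tor-independence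
(`TorIndependent.of_extVanishes`). Spectral sequences are avoided throughout by dimension shifting,
and `Tor_i(A, B) = 0` is expressed as `Ext^i(A, Hom(B, J)) = 0` for an injective cogenerator `J`.

Finally `stronglyTorIndependent_iff` translates the condition on the amplitudes of the derived
tensor products into Tor-independence of each `K_i` from the tensor products of later members. It
rests on the comparison of `P ⊗ X` with `A ⊗ X` for a projective resolution `P` of `A` and a complex
`X` of flat modules (`exists_d_eq_of_tensorAugment_eq_zero`, `exact_tensor_iff`).
-/

open scoped TensorProduct

/-! ### Ext groups and short exact sequences -/

section ExtTools

variable {R : Type u} [CommRing R]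

/-- `0 → A → B → C → 0` is a short exact sequence of `R`-modules. -/
structure IsShortExact {A B C : Type u} [AddCommGroup A] [AddCommGroup B] [AddCommGroup C]
    [Module R A] [Module R B] [Module R C] (f : A →ₗ[R] B) (g : B →ₗ[R] C) : Prop where
  injective : Function.Injective f
  exact : Function.Exact f g
  surjective : Function.Surjective g

theorem subsingleton_ext_of_linearEquiv {M M' N N' : ModuleCat.{u} R} (eM : M ≃ₗ[R] M')
    (eN : N ≃ₗ[R] N') {i : ℕ} (h : Subsingleton (Abelian.Ext M N i)) :
    Subsingleton (Abelian.Ext M' N' i) := by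
  refine subsingleton_of_forall_eq 0 fun x => ?_
  have h1 : ((Abelian.Ext.mk₀ eM.toModuleIso.hom).comp
      (x.comp (Abelian.Ext.mk₀ eN.toModuleIso.inv) (add_zero i)) (zero_add i)) = 0 :=
    Subsingleton.elim _ _
  have h2 : (Abelian.Ext.mk₀ eM.toModuleIso.inv).comp (((Abelian.Ext.mk₀ eM.toModuleIso.hom).comp
      (x.comp (Abelian.Ext.mk₀ eN.toModuleIso.inv) (add_zero i)) (zero_add i)).comp
      (Abelian.Ext.mk₀ eN.toModuleIso.hom) (add_zero i)) (zero_add i) = x := by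
    rw [Abelian.Ext.comp_assoc_of_third_deg_zero, Abelian.Ext.comp_assoc_of_third_deg_zero,
      Abelian.Ext.mk₀_comp_mk₀, Iso.inv_hom_id, Abelian.Ext.comp_mk₀_id,
      Abelian.Ext.mk₀_comp_mk₀_assoc, Iso.inv_hom_id, Abelian.Ext.mk₀_id_comp]
  rw [← h2, h1]
  simp

namespace IsShortExact

variable {A B C : ModuleCat.{u} R} {f : A →ₗ[R] B} {g : B →ₗ[R] C}

theorem comp_eq_zero (h : IsShortExact f g) : g ∘ₗ f = 0 :=
  LinearMap.ext fun x => (h.exact (f x)).2 ⟨x, rfl⟩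

/-- The short complex in `ModuleCat` attached to a short exact sequence of linear maps. -/
abbrev shortComplex (h : IsShortExact f g) : ShortComplex (ModuleCat.{u} R) :=
  ShortComplex.mk (ModuleCat.ofHom f) (ModuleCat.ofHom g) (by
    rw [← ModuleCat.ofHom_comp, h.comp_eq_zero]; rfl)

theorem shortExact (h : IsShortExact f g) : h.shortComplex.ShortExact :=
  ModuleCat.shortComplex_shortExact h.shortComplex h.exact h.injective h.surjective

theorem ext_third (h : IsShortExact f g) {N : ModuleCat.{u} R} {i : ℕ}
    (h1 : Subsingleton (Abelian.Ext A N i)) (h2 : Subsingleton (Abelian.Ext B N (i + 1))) :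
    Subsingleton (Abelian.Ext C N (i + 1)) := by
  refine subsingleton_of_forall_eq 0 fun x => ?_
  obtain ⟨y, rfl⟩ := Abelian.Ext.contravariant_sequence_exact₃ h.shortExact N x
    (Subsingleton.elim _ _) (n₀ := i) (add_comm _ _)
  rw [Subsingleton.elim y 0]; simp

theorem ext_first (h : IsShortExact f g) {N : ModuleCat.{u} R} {i : ℕ}
    (h2 : Subsingleton (Abelian.Ext B N i)) (h3 : Subsingleton (Abelian.Ext C N (i + 1))) :
    Subsingleton (Abelian.Ext A N i) := by
  refine subsingleton_of_forall_eq 0 fun x => ?_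
  obtain ⟨y, rfl⟩ := Abelian.Ext.contravariant_sequence_exact₁ h.shortExact N x
    (n₁ := i + 1) (add_comm _ _) (Subsingleton.elim _ _)
  rw [Subsingleton.elim y 0]; simp

theorem exists_extend (h : IsShortExact f g) {N : ModuleCat.{u} R}
    (h3 : Subsingleton (Abelian.Ext C N 1)) (φ : A →ₗ[R] N) : ∃ ψ : B →ₗ[R] N, ψ ∘ₗ f = φ := by
  obtain ⟨y, hy⟩ := Abelian.Ext.contravariant_sequence_exact₁ h.shortExact N
    (Abelian.Ext.mk₀ (ModuleCat.ofHom φ)) (n₁ := 1) (add_comm _ _) (Subsingleton.elim _ _)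
  obtain ⟨ψ, rfl⟩ := Abelian.Ext.mk₀_bijective _ _ |>.2 y
  rw [Abelian.Ext.mk₀_comp_mk₀] at hy
  have := (Abelian.Ext.mk₀_bijective _ _).1 hy
  exact ⟨ψ.hom, congrArg ModuleCat.Hom.hom this⟩

theorem ext_one_of_extend (h : IsShortExact f g) {N : ModuleCat.{u} R}
    (h1 : ∀ φ : A →ₗ[R] N, ∃ ψ : B →ₗ[R] N, ψ ∘ₗ f = φ)
    (h2 : Subsingleton (Abelian.Ext B N 1)) :
    Subsingleton (Abelian.Ext C N 1) := by
  refine subsingleton_of_forall_eq 0 fun x => ?_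
  obtain ⟨y, rfl⟩ := Abelian.Ext.contravariant_sequence_exact₃ h.shortExact N x
    (Subsingleton.elim _ _) (n₀ := 0) (add_comm _ _)
  obtain ⟨φ, rfl⟩ := Abelian.Ext.mk₀_bijective _ _ |>.2 y
  obtain ⟨ψ, hψ⟩ := h1 φ.hom
  have : φ = h.shortComplex.f ≫ ModuleCat.ofHom ψ := by ext x; exact (congr($hψ x)).symm
  rw [this, ← Abelian.Ext.mk₀_comp_mk₀]
  exact h.shortExact.extClass_comp_assoc _

theorem ext_first_of_third (h : IsShortExact f g) {M : ModuleCat.{u} R} {i : ℕ}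
    (h3 : Subsingleton (Abelian.Ext M C i)) (h2 : Subsingleton (Abelian.Ext M B (i + 1))) :
    Subsingleton (Abelian.Ext M A (i + 1)) := by
  refine subsingleton_of_forall_eq 0 fun x => ?_
  obtain ⟨y, rfl⟩ := Abelian.Ext.covariant_sequence_exact₁ M h.shortExact x
    (Subsingleton.elim _ _) (n₀ := i) rfl
  rw [Subsingleton.elim y 0]; simp

theorem exists_lift (h : IsShortExact f g) {M : ModuleCat.{u} R}
    (h1 : Subsingleton (Abelian.Ext M A 1)) (φ : M →ₗ[R] C) : ∃ ψ : M →ₗ[R] B, g ∘ₗ ψ = φ := by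
  obtain ⟨y, hy⟩ := Abelian.Ext.covariant_sequence_exact₃ M h.shortExact
    (Abelian.Ext.mk₀ (ModuleCat.ofHom φ)) (n₁ := 1) rfl (Subsingleton.elim _ _)
  obtain ⟨ψ, rfl⟩ := Abelian.Ext.mk₀_bijective _ _ |>.2 y
  rw [Abelian.Ext.mk₀_comp_mk₀] at hy
  have := (Abelian.Ext.mk₀_bijective _ _).1 hy
  exact ⟨ψ.hom, congrArg ModuleCat.Hom.hom this⟩

theorem ext_one_of_lift (h : IsShortExact f g) {M : ModuleCat.{u} R}
    (h3 : ∀ φ : M →ₗ[R] C, ∃ ψ : M →ₗ[R] B, g ∘ₗ ψ = φ)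
    (h2 : Subsingleton (Abelian.Ext M B 1)) :
    Subsingleton (Abelian.Ext M A 1) := by
  refine subsingleton_of_forall_eq 0 fun x => ?_
  obtain ⟨y, rfl⟩ := Abelian.Ext.covariant_sequence_exact₁ M h.shortExact x
    (Subsingleton.elim _ _) (n₀ := 0) rfl
  obtain ⟨φ, rfl⟩ := Abelian.Ext.mk₀_bijective _ _ |>.2 y
  obtain ⟨ψ, hψ⟩ := h3 φ.hom
  have : φ = ModuleCat.ofHom ψ ≫ h.shortComplex.g := by ext x; exact (congr($hψ x)).symm
  rw [this, ← Abelian.Ext.mk₀_comp_mk₀, Abelian.Ext.comp_assoc_of_second_deg_zero,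
    h.shortExact.comp_extClass, Abelian.Ext.comp_zero]

end IsShortExact

/-- The free module `R ^ n`. -/
abbrev freeModule (R : Type u) [CommRing R] (n : ℕ) : ModuleCat.{u} R := ModuleCat.of R (Fin n → R)

instance projective_freeModule (n : ℕ) : Projective (freeModule R n) :=
  (IsProjective.iff_projective (R := R) (Fin n → R)).1 inferInstance

theorem subsingleton_ext_of_projective (P : ModuleCat.{u} R) [Projective P] (N : ModuleCat.{u} R)
    {i : ℕ} (hi : 1 ≤ i) : Subsingleton (Abelian.Ext P N i) := by
  obtain ⟨i, rfl⟩ := Nat.exists_eq_add_of_le' hi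
  exact Abelian.Ext.subsingleton_of_projective P N i

theorem exists_presentation [IsNoetherianRing R] (A : ModuleCat.{u} R) [Module.Finite R A] :
    ∃ (n : ℕ) (A₁ : ModuleCat.{u} R) (_ : Module.Finite R A₁) (f : A₁ →ₗ[R] freeModule R n)
      (g : freeModule R n →ₗ[R] A), IsShortExact f g := by
  obtain ⟨n, g, hg⟩ := Module.Finite.exists_fin' R A
  exact ⟨n, ModuleCat.of R (LinearMap.ker g), inferInstance, (LinearMap.ker g).subtype, g,
    Subtype.val_injective, LinearMap.exact_subtype_ker_map g, hg⟩

/-- The map `B → A ⊗ B`, `b ↦ a ⊗ b`. -/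
noncomputable abbrev tmulLeft {A : ModuleCat.{u} R} (B : ModuleCat.{u} R) (a : A) : B ⟶ A ⊗ B :=
  ModuleCat.ofHom (TensorProduct.mk R A B a)

/-- The coordinate map `R ^ n ⊗ B → B`, `x ⊗ b ↦ x k • b`. -/
noncomputable abbrev tensorCoord {n : ℕ} (B : ModuleCat.{u} R) (k : Fin n) :
    freeModule R n ⊗ B ⟶ B :=
  ModuleCat.ofHom (TensorProduct.lift ((LinearMap.lsmul R B).comp (LinearMap.proj k)))

theorem tmulLeft_comp_tensorCoord {n : ℕ} (B : ModuleCat.{u} R) (y : Fin n → R) (k : Fin n) :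
    tmulLeft (A := freeModule R n) B y ≫ tensorCoord B k = y k • 𝟙 B := rfl

theorem sum_tensorCoord_comp_tmulLeft {n : ℕ} (B : ModuleCat.{u} R) :
    ∑ k : Fin n, tensorCoord B k ≫ tmulLeft (A := freeModule R n) B (Pi.single k 1 : Fin n → R)
      = 𝟙 (freeModule R n ⊗ B) := by
  apply ModuleCat.hom_ext
  apply TensorProduct.ext'
  intro x b
  have hx : x = ∑ k, x k • (Pi.single k 1 : Fin n → R) := by
    exact (pi_eq_sum_univ' x).trans (by simp [Pi.single])
  have : ((∑ k : Fin n, tensorCoord B k ≫ tmulLeft (A := freeModule R n) B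
      (Pi.single k 1 : Fin n → R)).hom (x ⊗ₜ[R] b)) = ∑ k : Fin n,
        (Pi.single k 1 : Fin n → R) ⊗ₜ[R] (x k • b) := by
    rw [ModuleCat.hom_sum, LinearMap.sum_apply]
    rfl
  rw [this]
  simp_rw [← TensorProduct.smul_tmul]
  rw [← TensorProduct.sum_tmul, ← hx]
  rfl

/-- An element of `Ext^i(R ^ n ⊗ B, N)` is determined by its components in `Ext^i(B, N)`. -/
theorem ext_freeModule_tensor_eq_sum {n : ℕ} {B N : ModuleCat.{u} R} {i : ℕ}
    (e : Abelian.Ext (freeModule R n ⊗ B) N i) :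
    e = ∑ k : Fin n, (Abelian.Ext.mk₀ (tensorCoord B k)).comp
      ((Abelian.Ext.mk₀ (tmulLeft (A := freeModule R n) B (Pi.single k 1 : Fin n → R))).comp e
        (zero_add i)) (zero_add i) := by
  conv_lhs => rw [← Abelian.Ext.mk₀_id_comp e, ← sum_tensorCoord_comp_tmulLeft,
    Abelian.Ext.mk₀_sum, Abelian.Ext.sum_comp]
  simp_rw [Abelian.Ext.mk₀_comp_mk₀_assoc]

theorem subsingleton_ext_freeModule_tensor {n : ℕ} {B N : ModuleCat.{u} R} {i : ℕ}
    (h : Subsingleton (Abelian.Ext B N i)) :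
    Subsingleton (Abelian.Ext (freeModule R n ⊗ B) N i) := by
  refine subsingleton_of_forall_eq 0 fun e => ?_
  rw [ext_freeModule_tensor_eq_sum e]
  refine Finset.sum_eq_zero fun k _ => ?_
  rw [Subsingleton.elim ((Abelian.Ext.mk₀ (tmulLeft B _)).comp e _) 0]
  simp

theorem subsingleton_ext_dagger_freeModule {n : ℕ} {M C : ModuleCat.{u} R} {i : ℕ}
    (h : Subsingleton (Abelian.Ext M C i)) :
    Subsingleton (Abelian.Ext M (dagger C (freeModule R n)) i) := by
  have key : ∑ k : Fin n, (ModuleCat.ofHom (LinearMap.applyₗ (Pi.single k 1 : Fin n → R)) :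
      dagger C (freeModule R n) ⟶ C) ≫ ModuleCat.ofHom
        ((LinearMap.llcomp R (Fin n → R) R C).flip (LinearMap.proj k) ∘ₗ
          (LinearMap.ringLmapEquivSelf R R C).symm.toLinearMap) =
      𝟙 (dagger C (freeModule R n)) := by
    apply ModuleCat.hom_ext
    rw [ModuleCat.hom_sum]
    ext φ k
    simp [LinearMap.sum_apply]
  refine subsingleton_of_forall_eq 0 fun e => ?_
  rw [← Abelian.Ext.comp_mk₀_id e, ← key, Abelian.Ext.mk₀_sum, Abelian.Ext.comp_sum]
  refine Finset.sum_eq_zero fun k _ => ?_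
  rw [← Abelian.Ext.mk₀_comp_mk₀, ← Abelian.Ext.comp_assoc_of_third_deg_zero,
    Subsingleton.elim (e.comp (Abelian.Ext.mk₀ _) _) 0]
  simp

end ExtTools

/-! ### Finitely generated modules over an Artinian local ring -/

section LocalAlgebra

variable {R : Type u} [CommRing R] [IsLocalRing R]

theorem exists_linearMap_to_residueField_ne_zero (A : Type*) [AddCommGroup A] [Module R A]
    [Module.Finite R A] [Nontrivial A] :
    ∃ f : A →ₗ[R] R ⧸ IsLocalRing.maximalIdeal R, f ≠ 0 := by
  obtain ⟨N, hN, -⟩ := (eq_top_or_exists_le_coatom (⊥ : Submodule R A)).resolve_left bot_ne_top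
  have : IsSimpleModule R (A ⧸ N) := isSimpleModule_iff_isCoatom.2 hN
  obtain ⟨I, hI, ⟨e⟩⟩ := isSimpleModule_iff_quot_maximal.1 this
  obtain rfl := IsLocalRing.eq_maximalIdeal hI
  refine ⟨e.toLinearMap ∘ₗ N.mkQ, fun h => hN.1 ?_⟩
  rw [eq_top_iff]
  intro x _
  have := LinearMap.congr_fun h x
  simpa using this

theorem exists_linearMap_from_residueField_injective [IsArtinianRing R] (E : Type*)
    [AddCommGroup E] [Module R E] [Nontrivial E] :
    ∃ f : (R ⧸ IsLocalRing.maximalIdeal R) →ₗ[R] E, Function.Injective f := by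
  obtain ⟨p, hp⟩ := associatedPrimes.nonempty R E
  obtain ⟨hp, f, hf⟩ := (isAssociatedPrime_iff_exists_injective_linearMap p E).1 hp
  obtain rfl := IsLocalRing.eq_maximalIdeal (IsArtinianRing.isMaximal_of_isPrime p)
  exact ⟨f, hf⟩

/-- Over an Artinian local ring a nonzero finitely generated module maps onto the residue field,
which embeds into every nonzero module. -/
theorem exists_linearMap_ne_zero [IsArtinianRing R] (A E : Type*) [AddCommGroup A] [Module R A]
    [Module.Finite R A] [Nontrivial A] [AddCommGroup E] [Module R E] [Nontrivial E] :
    ∃ f : A →ₗ[R] E, f ≠ 0 := by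
  obtain ⟨f, hf⟩ := exists_linearMap_to_residueField_ne_zero (R := R) A
  obtain ⟨g, hg⟩ := exists_linearMap_from_residueField_injective (R := R) E
  refine ⟨g ∘ₗ f, fun h => hf ?_⟩
  ext x
  exact hg (by simpa using LinearMap.congr_fun h x)

theorem nontrivial_tensorProduct_of_finite (A B : Type*) [AddCommGroup A] [Module R A]
    [Module.Finite R A] [Nontrivial A] [AddCommGroup B] [Module R B] [Module.Finite R B]
    [Nontrivial B] : Nontrivial (A ⊗[R] B) := by
  obtain ⟨f, hf⟩ := exists_linearMap_to_residueField_ne_zero (R := R) A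
  obtain ⟨g, hg⟩ := exists_linearMap_to_residueField_ne_zero (R := R) B
  obtain ⟨a, ha⟩ := DFunLike.ne_iff.1 hf
  obtain ⟨b, hb⟩ := DFunLike.ne_iff.1 hg
  refine ⟨a ⊗ₜ b, 0, fun h => mul_ne_zero ha hb ?_⟩
  simpa using congrArg (LinearMap.mul' R _ ∘ₗ TensorProduct.map f g) h

theorem subsingleton_of_forall_linearMap_eq_zero [IsArtinianRing R] {A E : Type*} [AddCommGroup A]
    [Module R A] [Module.Finite R A] [AddCommGroup E] [Module R E] [Nontrivial E]
    (h : ∀ f : A →ₗ[R] E, f = 0) : Subsingleton A := by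
  by_contra hA
  rw [not_subsingleton_iff_nontrivial] at hA
  obtain ⟨f, hf⟩ := exists_linearMap_ne_zero (R := R) A E
  exact hf (h f)

end LocalAlgebra

/-! ### An injective cogenerator -/

section CharacterDual

variable (R : Type u) [CommRing R]

/-- The injective cogenerator `Hom_ℤ(R, ℚ/ℤ)` of the category of `R`-modules. -/
abbrev charModule : ModuleCat.{u} R := ModuleCat.of R (CharacterModule R)

instance injective_charModule : Injective (charModule R) :=
  (Module.injective_iff_injective_object R (CharacterModule R)).1
    (Module.Flat.iff_characterModule_injective.1 inferInstance)

variable {R}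

theorem exists_charModule_apply_ne_zero {M : Type*} [AddCommGroup M] [Module R M] {m : M}
    (hm : m ≠ 0) : ∃ f : M →ₗ[R] charModule R, f m ≠ 0 := by
  obtain ⟨c, hc⟩ := CharacterModule.exists_character_apply_ne_zero_of_ne_zero hm
  refine ⟨(CharacterModule.dual (TensorProduct.rid R M).toLinearMap c |> CharacterModule.curry),
    fun h => hc ?_⟩
  have := DFunLike.congr_fun h (1 : R)
  change c (TensorProduct.rid R M (m ⊗ₜ[R] (1 : R))) = 0 at this
  rwa [TensorProduct.rid_tmul, one_smul] at this

theorem subsingleton_ext_charModule (M : ModuleCat.{u} R) {i : ℕ} (hi : 1 ≤ i) :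
    Subsingleton (Abelian.Ext M (charModule R) i) := by
  obtain ⟨i, rfl⟩ := Nat.exists_eq_add_of_le' hi
  exact Abelian.Ext.subsingleton_of_injective M _ i

end CharacterDual

/-! ### Tor-independence and dimension shifting -/

section DimensionShifting

variable {R : Type u} [CommRing R]

/-- `Ext^i(M, N) = 0` for all `i ≥ 1`. -/
def ExtVanishes (M N : ModuleCat.{u} R) : Prop :=
  ∀ i, 1 ≤ i → Subsingleton (Abelian.Ext M N i)

/-- Tor-independence of `A` and `B`, i.e. `Tor_i(A, B) = 0` for all `i ≥ 1`, expressed through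
`Ext^i(A, Hom(B, J)) = Hom(Tor_i(A, B), J)` for the injective cogenerator `J = charModule R`. -/
def TorIndependent (A B : ModuleCat.{u} R) : Prop :=
  ExtVanishes A (dagger (charModule R) B)

theorem ExtVanishes.congr {M M' N N' : ModuleCat.{u} R} (h : ExtVanishes M N) (eM : M ≃ₗ[R] M')
    (eN : N ≃ₗ[R] N') : ExtVanishes M' N' :=
  fun i hi => subsingleton_ext_of_linearEquiv eM eN (h i hi)

theorem TorIndependent.congr {A A' B B' : ModuleCat.{u} R} (h : TorIndependent A B)
    (eA : A ≃ₗ[R] A') (eB : B ≃ₗ[R] B') : TorIndependent A' B' :=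
  ExtVanishes.congr h eA (LinearEquiv.arrowCongr eB (LinearEquiv.refl R _))

/-- Currying: `Hom(A, Hom(B, N)) ≃ Hom(A ⊗ B, N)`. -/
noncomputable abbrev daggerCurry (A B N : ModuleCat.{u} R) :
    dagger (dagger N B) A ≃ₗ[R] dagger N (A ⊗ B) :=
  TensorProduct.lift.equiv (RingHom.id R) A B N

variable {A₁ F A B C N : ModuleCat.{u} R}

/-- The dual of a short exact sequence is exact if `Ext^1` of its third term vanishes. -/
theorem IsShortExact.dagger {f : A₁ →ₗ[R] F} {g : F →ₗ[R] A} (h : IsShortExact f g)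
    (hA : Subsingleton (Abelian.Ext A C 1)) :
    IsShortExact (A := dagger C A) (B := dagger C F) (C := dagger C A₁)
      (LinearMap.lcomp R C g) (LinearMap.lcomp R C f) where
  injective φ ψ hφ := by
    ext x
    obtain ⟨y, rfl⟩ := h.surjective x
    exact LinearMap.congr_fun hφ y
  exact := LinearMap.exact_lcomp_of_exact_of_surjective _ h.exact h.surjective
  surjective φ := h.exists_extend hA φ

/-- A short exact sequence ending in `A` stays exact under `- ⊗ B` if `Tor_1(A, B) = 0`. -/
theorem IsShortExact.tensor {f : A₁ →ₗ[R] F} {g : F →ₗ[R] A} (h : IsShortExact f g)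
    (hAB : Subsingleton (Abelian.Ext A (_root_.dagger (charModule R) B) 1)) :
    IsShortExact (A := (A₁ ⊗ B : ModuleCat.{u} R)) (B := (F ⊗ B : ModuleCat.{u} R))
      (C := (A ⊗ B : ModuleCat.{u} R)) (f.rTensor B) (g.rTensor B) where
  injective := by
    rw [injective_iff_map_eq_zero]
    intro x hx
    by_contra hne
    obtain ⟨φ, hφ⟩ := exists_charModule_apply_ne_zero (R := R) hne
    obtain ⟨ψ, hψ⟩ := h.exists_extend hAB (TensorProduct.curry φ)
    have : φ = TensorProduct.lift ψ ∘ₗ f.rTensor B := by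
      apply TensorProduct.ext'
      intro a b
      exact (congr($hψ a b)).symm
    exact hφ (by rw [this, LinearMap.comp_apply, hx, map_zero])
  exact := rTensor_exact B h.exact h.surjective
  surjective := LinearMap.rTensor_surjective B h.surjective

theorem ExtVanishes.of_presentation {n : ℕ} {f : A₁ →ₗ[R] freeModule R n}
    {g : freeModule R n →ₗ[R] A} (h : IsShortExact f g) (hA : ExtVanishes A N) :
    ExtVanishes A₁ N := fun i hi =>
  h.ext_first (subsingleton_ext_of_projective _ _ hi) (hA (i + 1) (by omega))

/-- Tensor-hom adjunction for extension problems. -/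
theorem extend_iff_extend_tensor {f : A₁ →ₗ[R] F} :
    (∀ φ : A₁ →ₗ[R] (B →ₗ[R] N), ∃ ψ : F →ₗ[R] (B →ₗ[R] N), ψ ∘ₗ f = φ) ↔
      ∀ φ : A₁ ⊗[R] B →ₗ[R] N, ∃ ψ : F ⊗[R] B →ₗ[R] N, ψ ∘ₗ f.rTensor B = φ := by
  constructor
  · intro h φ
    obtain ⟨ψ, hψ⟩ := h (TensorProduct.curry φ)
    exact ⟨TensorProduct.lift ψ, TensorProduct.ext' fun a b => congr($hψ a b)⟩
  · intro h φ
    obtain ⟨ψ, hψ⟩ := h (TensorProduct.lift φ)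
    exact ⟨TensorProduct.curry ψ, LinearMap.ext₂ fun a b => by
      simpa using congr($hψ (a ⊗ₜ b))⟩

variable [IsNoetherianRing R]

/-- If the higher `Ext` groups of `A` and `B` into `C` vanish, then `Ext^i(A, Hom(B, C))` and
`Ext^i(B, Hom(A, C))` are both the `i`-th cohomology of `RHom(A ⊗ᴸ B, C)`. The induction passes from
`A` to a syzygy of `A`. -/
theorem subsingleton_ext_dagger_swap {i : ℕ} (hi : 1 ≤ i) [Module.Finite R A]
    (hA : ExtVanishes A C) (hB : ExtVanishes B C)
    (h : Subsingleton (Abelian.Ext A (dagger C B) i)) :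
    Subsingleton (Abelian.Ext B (dagger C A) i) := by
  induction i, hi using Nat.le_induction generalizing A with
  | base =>
    obtain ⟨n, A₁, _, f, g, hfg⟩ := exists_presentation A
    refine IsShortExact.ext_one_of_lift (A := dagger C A) (B := dagger C (freeModule R n))
      (C := dagger C A₁) (hfg.dagger (hA 1 le_rfl)) (fun φ => ?_)
      (subsingleton_ext_dagger_freeModule (hB 1 le_rfl))
    obtain ⟨ψ, hψ⟩ := hfg.exists_extend h φ.flip
    exact ⟨ψ.flip, LinearMap.ext₂ fun b a => congr($hψ a b)⟩
  | succ i hi ih =>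
    obtain ⟨n, A₁, _, f, g, hfg⟩ := exists_presentation A
    refine IsShortExact.ext_first_of_third (A := dagger C A) (B := dagger C (freeModule R n))
      (C := dagger C A₁) (hfg.dagger (hA 1 le_rfl)) (ih (hA.of_presentation hfg) ?_)
      (subsingleton_ext_dagger_freeModule (hB (i + 1) (by omega)))
    exact hfg.ext_first (subsingleton_ext_of_projective _ _ hi) h

theorem TorIndependent.symm [Module.Finite R A] (h : TorIndependent A B) : TorIndependent B A :=
  fun i hi => subsingleton_ext_dagger_swap hi (fun _ => subsingleton_ext_charModule _)
    (fun _ => subsingleton_ext_charModule _) (h i hi)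

/-- The isomorphism `Ext^i(A ⊗ B, N) = Ext^i(A, Hom(B, N))`, at the level of vanishing, for
Tor-independent `A` and `B` when the groups `Ext^q(B, N)` vanish for `1 ≤ q ≤ i`. -/
theorem subsingleton_ext_tensor_iff {i : ℕ} (hi : 1 ≤ i) [Module.Finite R A]
    (hAB : TorIndependent A B)
    (hB : ∀ q, 1 ≤ q → q ≤ i → Subsingleton (Abelian.Ext B N q)) :
    Subsingleton (Abelian.Ext (A ⊗ B) N i) ↔ Subsingleton (Abelian.Ext A (dagger N B) i) := by
  induction i, hi using Nat.le_induction generalizing A with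
  | base =>
    obtain ⟨n, A₁, _, f, g, hfg⟩ := exists_presentation A
    have ht := hfg.tensor (hAB 1 le_rfl)
    constructor
    · intro h
      exact hfg.ext_one_of_extend (extend_iff_extend_tensor.2 fun φ =>
        ht.exists_extend (A := A₁ ⊗ B) (B := freeModule R n ⊗ B) (C := A ⊗ B) h φ)
        (subsingleton_ext_of_projective _ _ le_rfl)
    · intro h
      exact ht.ext_one_of_extend (A := A₁ ⊗ B) (B := freeModule R n ⊗ B) (C := A ⊗ B)
        (extend_iff_extend_tensor.1 fun φ => hfg.exists_extend h φ)
        (subsingleton_ext_freeModule_tensor (hB 1 le_rfl le_rfl))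
  | succ i hi ih =>
    obtain ⟨n, A₁, _, f, g, hfg⟩ := exists_presentation A
    have ht := hfg.tensor (hAB 1 le_rfl)
    have ih' := ih (A := A₁) (ExtVanishes.of_presentation hfg hAB)
      (fun q hq hqi => hB q hq (by omega))
    constructor
    · intro h
      exact hfg.ext_third (ih'.1 (ht.ext_first (A := A₁ ⊗ B) (B := freeModule R n ⊗ B)
        (C := A ⊗ B) (subsingleton_ext_freeModule_tensor (hB i hi (by omega))) h))
        (subsingleton_ext_of_projective _ _ (by omega))
    · intro h
      exact ht.ext_third (A := A₁ ⊗ B) (B := freeModule R n ⊗ B) (C := A ⊗ B)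
        (ih'.2 (hfg.ext_first (subsingleton_ext_of_projective _ _ hi) h))
        (subsingleton_ext_freeModule_tensor (hB (i + 1) (by omega) le_rfl))

/-- Associativity of the derived tensor product, at the level of Tor-independence. -/
theorem TorIndependent.tensor_left_iff [Module.Finite R A] (hAB : TorIndependent A B)
    (hBC : TorIndependent B C) : TorIndependent (A ⊗ B) C ↔ TorIndependent A (B ⊗ C) := by
  have key : ∀ i, 1 ≤ i → (Subsingleton (Abelian.Ext (A ⊗ B) (dagger (charModule R) C) i) ↔
      Subsingleton (Abelian.Ext A (dagger (charModule R) (B ⊗ C)) i)) := fun i hi => by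
    rw [subsingleton_ext_tensor_iff hi hAB fun q hq _ => hBC q hq]
    exact ⟨subsingleton_ext_of_linearEquiv (LinearEquiv.refl R _) (daggerCurry _ _ _),
      subsingleton_ext_of_linearEquiv (LinearEquiv.refl R _) (daggerCurry _ _ _).symm⟩
  exact ⟨fun h i hi => (key i hi).1 (h i hi), fun h i hi => (key i hi).2 (h i hi)⟩

end DimensionShifting

/-! ### Ext groups of tensor products -/

section ExtOfTensor

variable {R : Type u} [CommRing R] [IsNoetherianRing R] {A B C N : ModuleCat.{u} R}

/-- The kernel of `Ext^(i+1)(A ⊗ B, N) → Hom(A, Ext^(i+1)(B, N))` is `Ext^(i+1)(A, Hom(B, N))` when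
`A` and `B` are Tor-independent and `Ext^q(B, N) = 0` for `1 ≤ q ≤ i`; here it is assumed to be
zero. -/
theorem ext_tensor_eq_zero_of_tmulLeft {i : ℕ} [Module.Finite R A] (hAB : TorIndependent A B)
    (hB : ∀ q, 1 ≤ q → q ≤ i → Subsingleton (Abelian.Ext B N q))
    (h : Subsingleton (Abelian.Ext A (dagger N B) (i + 1)))
    (e : Abelian.Ext (A ⊗ B) N (i + 1))
    (he : ∀ a : A, (Abelian.Ext.mk₀ (tmulLeft B a)).comp e (zero_add _) = 0) : e = 0 := by
  obtain ⟨n, A₁, _, f, g, hfg⟩ := exists_presentation A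
  have ht : IsShortExact (A := (A₁ ⊗ B : ModuleCat.{u} R))
    (B := (freeModule R n ⊗ B : ModuleCat.{u} R)) (C := (A ⊗ B : ModuleCat.{u} R)) _ _ :=
    hfg.tensor (hAB 1 le_rfl)
  let S := IsShortExact.shortComplex (A := A₁ ⊗ B) (B := freeModule R n ⊗ B) (C := A ⊗ B) ht
  have hS : S.ShortExact := ht.shortExact (A := A₁ ⊗ B) (B := freeModule R n ⊗ B) (C := A ⊗ B)
  have h0 : (Abelian.Ext.mk₀ S.g).comp e (zero_add _) = 0 := by
    refine (ext_freeModule_tensor_eq_sum _).trans (Finset.sum_eq_zero fun k _ => ?_)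
    have : (Abelian.Ext.mk₀ (tmulLeft (A := freeModule R n) B (Pi.single k 1 : Fin n → R))).comp
        ((Abelian.Ext.mk₀ S.g).comp e (zero_add _)) (zero_add _) = 0 := by
      rw [Abelian.Ext.mk₀_comp_mk₀_assoc]
      exact he (g (Pi.single k 1 : Fin n → R))
    rw [this]
    simp
  obtain ⟨y, rfl⟩ := Abelian.Ext.contravariant_sequence_exact₃ hS N e h0 (n₀ := i)
    (add_comm _ _)
  rcases Nat.eq_zero_or_pos i with rfl | hi
  · obtain ⟨φ, rfl⟩ := Abelian.Ext.mk₀_bijective _ _ |>.2 y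
    obtain ⟨ψ, hψ⟩ := (extend_iff_extend_tensor (B := B) (N := N) (f := f)).1
      (fun φ => hfg.exists_extend (N := dagger N B) h φ) φ.hom
    have : φ = S.f ≫ (ModuleCat.ofHom ψ : freeModule R n ⊗ B ⟶ N) := by
      apply ModuleCat.hom_ext
      exact hψ.symm
    rw [this, ← Abelian.Ext.mk₀_comp_mk₀]
    exact hS.extClass_comp_assoc _
  · have : Subsingleton (Abelian.Ext (A₁ ⊗ B) N i) :=
      (subsingleton_ext_tensor_iff hi (ExtVanishes.of_presentation hfg hAB) hB).2
        (hfg.ext_first (subsingleton_ext_of_projective _ _ hi) h)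
    rw [Subsingleton.elim y 0]
    simp

/-- Cancellation of a Tor-independent factor. If `A ≠ 0` and `B` are Tor-independent, then
`Ext^i(A ⊗ B, N)` is the abutment of a spectral sequence with `E₂ = Ext^p(A, Ext^q(B, N))`, and the
lowest nonvanishing `Ext^q(B, N)` with `q ≥ 1` contributes `Hom(A, Ext^q(B, N)) ≠ 0`. -/
theorem ExtVanishes.of_tensor [IsLocalRing R] [IsArtinianRing R] [Module.Finite R A] [Nontrivial A]
    (hAB : TorIndependent A B) (h : ExtVanishes (A ⊗ B) N) (h' : ExtVanishes A (dagger N B)) :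
    ExtVanishes B N := by
  intro i
  induction i using Nat.strong_induction_on with
  | _ i ih =>
  intro hi
  obtain ⟨i, rfl⟩ := Nat.exists_eq_add_of_le' hi
  by_contra hne
  rw [not_subsingleton_iff_nontrivial] at hne
  obtain ⟨f, hf⟩ := exists_linearMap_ne_zero (R := R) A (Abelian.Ext B N (i + 1))
  obtain ⟨n, A₁, _, s, g, hfg⟩ := exists_presentation A
  have ht : IsShortExact (A := (A₁ ⊗ B : ModuleCat.{u} R))
    (B := (freeModule R n ⊗ B : ModuleCat.{u} R)) (C := (A ⊗ B : ModuleCat.{u} R)) _ _ :=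
    hfg.tensor (hAB 1 le_rfl)
  let S := IsShortExact.shortComplex (A := A₁ ⊗ B) (B := freeModule R n ⊗ B) (C := A ⊗ B) ht
  have hS : S.ShortExact := ht.shortExact (A := A₁ ⊗ B) (B := freeModule R n ⊗ B) (C := A ⊗ B)
  -- the element of `Ext(F ⊗ B, N) = Hom(F, Ext(B, N))` given by `f ∘ g`
  let e : Abelian.Ext (freeModule R n ⊗ B) N (i + 1) := ∑ k : Fin n,
    (Abelian.Ext.mk₀ (tensorCoord B k)).comp (f (g (Pi.single k 1 : Fin n → R))) (zero_add _)
  have he : ∀ y : Fin n → R, (Abelian.Ext.mk₀ (tmulLeft (A := freeModule R n) B y)).comp e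
      (zero_add _) = f (g y) := by
    intro y
    have hy : y = ∑ k, y k • (Pi.single k 1 : Fin n → R) :=
      (pi_eq_sum_univ' y).trans (by simp [Pi.single])
    rw [Abelian.Ext.comp_sum]
    conv_rhs => rw [hy]
    rw [map_sum, map_sum]
    refine Finset.sum_congr rfl fun k _ => ?_
    rw [Abelian.Ext.mk₀_comp_mk₀_assoc, tmulLeft_comp_tensorCoord, Abelian.Ext.mk₀_smul,
      Abelian.Ext.smul_comp, Abelian.Ext.mk₀_id_comp, map_smul, map_smul]
  have h0 : (Abelian.Ext.mk₀ S.f).comp e (zero_add _) = 0 := by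
    refine ext_tensor_eq_zero_of_tmulLeft (A := A₁) (ExtVanishes.of_presentation hfg hAB)
      (fun q hq hqi => ih q (by omega) hq)
      (ExtVanishes.of_presentation hfg h' (i + 1) (by omega)) _ fun a => ?_
    rw [Abelian.Ext.mk₀_comp_mk₀_assoc]
    refine (he (s a)).trans ?_
    rw [(hfg.exact (s a)).2 ⟨a, rfl⟩, map_zero]
  obtain ⟨x, hx⟩ := Abelian.Ext.contravariant_sequence_exact₂ hS N e h0
  have := h (i + 1) (by omega)
  have he0 : e = 0 := by
    rw [← hx, Subsingleton.elim (h := this) x 0]; simp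
  refine hf (LinearMap.ext fun a => ?_)
  obtain ⟨y, rfl⟩ := hfg.surjective a
  rw [← he y, he0]
  simp

/-- `Hom(Tor_1(A, B), C) = 0` as it lies between `Ext^1(A, Hom(B, C))` and `Ext^2(A ⊗ B, C)`; the
higher groups follow by passing to a syzygy of `A`. -/
theorem TorIndependent.of_extVanishes [IsLocalRing R] [IsArtinianRing R] [Module.Finite R A]
    [Module.Finite R B] [Nontrivial C] (h1 : ExtVanishes A (dagger C B)) (h2 : ExtVanishes B C)
    (h3 : ∀ i, 2 ≤ i → Subsingleton (Abelian.Ext (A ⊗ B) C i)) : TorIndependent A B := by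
  intro i hi
  have key : ∀ (A : ModuleCat.{u} R) [Module.Finite R A], ExtVanishes A (dagger C B) →
      Subsingleton (Abelian.Ext (A ⊗ B) C 2) → Subsingleton (Abelian.Ext A
        (dagger (charModule R) B) 1) := by
    intro A _ h1 h3
    obtain ⟨n, A₁, _, f, g, hfg⟩ := exists_presentation A
    let T : ModuleCat.{u} R := ModuleCat.of R (LinearMap.ker (f.rTensor B))
    let V : ModuleCat.{u} R := ModuleCat.of R (LinearMap.range (f.rTensor B))
    have hT : IsShortExact (A := T) (B := (A₁ ⊗ B : ModuleCat.{u} R)) (C := V)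
        (LinearMap.ker (f.rTensor B)).subtype (f.rTensor B).rangeRestrict :=
      ⟨Subtype.val_injective, by
        rw [LinearMap.exact_iff, Submodule.range_subtype, LinearMap.ker_rangeRestrict],
        LinearMap.surjective_rangeRestrict _⟩
    have hV : IsShortExact (A := V) (B := (freeModule R n ⊗ B : ModuleCat.{u} R))
        (C := (A ⊗ B : ModuleCat.{u} R))
        (LinearMap.range (f.rTensor B)).subtype (g.rTensor B) :=
      ⟨Subtype.val_injective, by
        rw [LinearMap.exact_iff, Submodule.range_subtype]
        exact LinearMap.exact_iff.1 (rTensor_exact B hfg.exact hfg.surjective),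
        LinearMap.rTensor_surjective B hfg.surjective⟩
    have hV1 : Subsingleton (Abelian.Ext V C 1) := hV.ext_first (A := V)
      (B := freeModule R n ⊗ B) (C := A ⊗ B) (subsingleton_ext_freeModule_tensor (h2 1 le_rfl)) h3
    have hT0 : Subsingleton (LinearMap.ker (f.rTensor B)) := by
      have : Module.Finite R (A₁ ⊗[R] B) := inferInstance
      have : Module.Finite R (LinearMap.ker (f.rTensor B)) := inferInstance
      refine subsingleton_of_forall_linearMap_eq_zero (R := R) (E := C) fun θ => ?_
      obtain ⟨φ, hφ⟩ := hT.exists_extend (A := T) (B := A₁ ⊗ B) (C := V) hV1 θ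
      obtain ⟨ψ, hψ⟩ := (extend_iff_extend_tensor (B := B) (N := C) (f := f)).1
        (fun φ => hfg.exists_extend (N := dagger C B) (h1 1 le_rfl) φ) φ
      ext x
      have hx : φ x.1 = θ x := LinearMap.congr_fun hφ x
      rw [← hx, ← hψ, LinearMap.comp_apply, x.2, map_zero, LinearMap.zero_apply]
    have ht : IsShortExact (A := (A₁ ⊗ B : ModuleCat.{u} R))
        (B := (freeModule R n ⊗ B : ModuleCat.{u} R)) (C := (A ⊗ B : ModuleCat.{u} R))
        (f.rTensor B) (g.rTensor B) :=
      ⟨LinearMap.ker_eq_bot.1 ((Submodule.subsingleton_iff_eq_bot).1 hT0),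
        rTensor_exact B hfg.exact hfg.surjective, LinearMap.rTensor_surjective B hfg.surjective⟩
    exact hfg.ext_one_of_extend
      (extend_iff_extend_tensor.2 fun φ => ht.exists_extend (A := A₁ ⊗ B)
        (B := freeModule R n ⊗ B) (C := A ⊗ B) (subsingleton_ext_charModule _ le_rfl) φ)
      (subsingleton_ext_of_projective _ _ le_rfl)
  induction i, hi using Nat.le_induction generalizing A with
  | base => exact key A h1 (h3 2 le_rfl)
  | succ i hi ih =>
    obtain ⟨n, A₁, _, f, g, hfg⟩ := exists_presentation A
    have ht : IsShortExact (A := (A₁ ⊗ B : ModuleCat.{u} R))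
      (B := (freeModule R n ⊗ B : ModuleCat.{u} R)) (C := (A ⊗ B : ModuleCat.{u} R)) _ _ :=
      hfg.tensor (key A h1 (h3 2 le_rfl))
    refine hfg.ext_third (ih (h1.of_presentation hfg) fun j hj => ?_)
      (subsingleton_ext_of_projective _ _ (by omega))
    exact ht.ext_first (A := A₁ ⊗ B) (B := freeModule R n ⊗ B) (C := A ⊗ B)
      (subsingleton_ext_freeModule_tensor (h2 j (by omega))) (h3 (j + 1) (by omega))

end ExtOfTensor

/-! ### Criteria for bijectivity -/

section HomCriteria

variable {R : Type u} [CommRing R] [IsLocalRing R] [IsArtinianRing R] {X C : ModuleCat.{u} R}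

/-- A map `e : X → C` is bijective if it induces an isomorphism `Hom(C, C) → Hom(X, C)` and
`Ext^1(C, C) = 0`: then the kernel and the cokernel of `e` have no nonzero maps to `C`. -/
theorem bijective_of_precomp [Module.Finite R X] [Module.Finite R C] [Nontrivial C]
    (hC : Subsingleton (Abelian.Ext C C 1)) (e : X →ₗ[R] C)
    (h1 : ∀ φ : C →ₗ[R] C, φ ∘ₗ e = 0 → φ = 0)
    (h2 : ∀ ψ : X →ₗ[R] C, ∃ φ : C →ₗ[R] C, φ ∘ₗ e = ψ) :
    Function.Bijective e := by
  have hsurj : Function.Surjective e := by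
    rw [← LinearMap.range_eq_top, ← Submodule.Quotient.subsingleton_iff]
    refine subsingleton_of_forall_linearMap_eq_zero (R := R) (E := C) fun h => ?_
    have := h1 (h ∘ₗ (LinearMap.range e).mkQ) (by
      rw [LinearMap.comp_assoc, LinearMap.range_mkQ_comp, LinearMap.comp_zero])
    exact Submodule.linearMap_qext _ this
  refine ⟨?_, hsurj⟩
  have hK : IsShortExact (A := ModuleCat.of R (LinearMap.ker e)) (LinearMap.ker e).subtype e :=
    ⟨Subtype.val_injective, LinearMap.exact_subtype_ker_map e, hsurj⟩
  rw [← LinearMap.ker_eq_bot, ← Submodule.subsingleton_iff_eq_bot]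
  refine subsingleton_of_forall_linearMap_eq_zero (R := R) (E := C) fun h => ?_
  obtain ⟨ψ, hψ⟩ := hK.exists_extend (A := ModuleCat.of R (LinearMap.ker e)) hC h
  obtain ⟨φ, rfl⟩ := h2 ψ
  ext x
  have := LinearMap.congr_fun hψ x
  rw [← this]
  simp

/-- A map `e : C → X` is bijective if it induces an isomorphism `Hom(C, C) → Hom(C, X)` and
`Ext^1(C, C) = 0`: then `C` has no nonzero maps to the kernel and the cokernel of `e`. Here `X` need
not be finitely generated. -/
theorem bijective_of_postcomp [Module.Finite R C] [Nontrivial C]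
    (hC : Subsingleton (Abelian.Ext C C 1)) (e : C →ₗ[R] X)
    (h1 : ∀ φ : C →ₗ[R] C, e ∘ₗ φ = 0 → φ = 0)
    (h2 : ∀ ψ : C →ₗ[R] X, ∃ φ : C →ₗ[R] C, e ∘ₗ φ = ψ) :
    Function.Bijective e := by
  have hinj : Function.Injective e := by
    rw [← LinearMap.ker_eq_bot, ← Submodule.subsingleton_iff_eq_bot]
    by_contra hne
    rw [not_subsingleton_iff_nontrivial] at hne
    obtain ⟨f, hf⟩ := exists_linearMap_ne_zero (R := R) C (LinearMap.ker e)
    have := h1 ((LinearMap.ker e).subtype ∘ₗ f) (by ext x; simp)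
    exact hf (by ext x; simpa using LinearMap.congr_fun this x)
  refine ⟨hinj, ?_⟩
  have hK : IsShortExact (C := ModuleCat.of R (X ⧸ LinearMap.range e)) e (LinearMap.range e).mkQ :=
    ⟨hinj, LinearMap.exact_map_mkQ_range e, Submodule.mkQ_surjective _⟩
  rw [← LinearMap.range_eq_top, ← Submodule.Quotient.subsingleton_iff]
  by_contra hne
  rw [not_subsingleton_iff_nontrivial] at hne
  obtain ⟨f, hf⟩ := exists_linearMap_ne_zero (R := R) C (X ⧸ LinearMap.range e)
  obtain ⟨ψ, hψ⟩ := hK.exists_lift (C := ModuleCat.of R (X ⧸ LinearMap.range e)) hC f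
  obtain ⟨φ, rfl⟩ := h2 ψ
  refine hf ?_
  rw [← hψ]
  ext x
  simp

end HomCriteria

/-! ### Semidualizing and totally reflexive modules -/

section Semidualizing

variable {R : Type u} [CommRing R]

theorem IsSemidualizing.congr {C C' : ModuleCat.{u} R} (h : IsSemidualizing C) (e : C ≃ₗ[R] C') :
    IsSemidualizing C' where
  finite := have := h.finite; Module.Finite.equiv e
  homothety_bijective := by
    have : ⇑(LinearMap.lsmul R C') = ⇑e.conj ∘ ⇑(LinearMap.lsmul R C) := by
      ext r x
      simp [LinearEquiv.conj_apply]
    rw [this]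
    exact e.conj.bijective.comp h.homothety_bijective
  ext_eq_zero := ExtVanishes.congr h.ext_eq_zero e e

theorem IsTotallyReflexive.congr {C C' M M' : ModuleCat.{u} R} (h : IsTotallyReflexive C M)
    (eC : C ≃ₗ[R] C') (eM : M ≃ₗ[R] M') : IsTotallyReflexive C' M' where
  finite := have := h.finite; Module.Finite.equiv eM
  biduality_bijective := by
    have : ⇑(LinearMap.applyₗ : M' →ₗ[R] (M' →ₗ[R] C') →ₗ[R] C') =
        ⇑(LinearEquiv.arrowCongr (LinearEquiv.arrowCongr eM eC) eC) ∘
          ⇑(LinearMap.applyₗ : M →ₗ[R] (M →ₗ[R] C) →ₗ[R] C) ∘ ⇑eM.symm := by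
      ext m f
      simp
    rw [this]
    exact (LinearEquiv.bijective _).comp (h.biduality_bijective.comp eM.symm.bijective)
  ext_eq_zero := ExtVanishes.congr h.ext_eq_zero eM eC
  ext_dual_eq_zero := ExtVanishes.congr h.ext_dual_eq_zero (LinearEquiv.arrowCongr eM eC) eC

theorem IsSemidualizing.nontrivial [Nontrivial R] {C : ModuleCat.{u} R} (h : IsSemidualizing C) :
    Nontrivial C := by
  by_contra hC
  rw [not_nontrivial_iff_subsingleton] at hC
  exact one_ne_zero (h.homothety_bijective.1 (a₁ := 1) (a₂ := 0) (Subsingleton.elim _ _))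

theorem IsSemidualizing.exists_smul_eq {C : ModuleCat.{u} R} (h : IsSemidualizing C)
    (φ : C →ₗ[R] C) : ∃ r : R, ∀ c, φ c = r • c := by
  obtain ⟨r, rfl⟩ := h.homothety_bijective.2 φ
  exact ⟨r, fun _ => rfl⟩

theorem IsSemidualizing.eq_zero_of_smul {C : ModuleCat.{u} R} (h : IsSemidualizing C) {r : R}
    (hr : ∀ c : C, r • c = 0) : r = 0 :=
  h.homothety_bijective.1 (LinearMap.ext fun c => by
    rw [LinearMap.lsmul_apply, LinearMap.lsmul_apply, hr c, zero_smul])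

/-- A free semidualizing module has rank one, since its endomorphism ring is `R`. -/
theorem IsSemidualizing.nonempty_linearEquiv_of_free [Nontrivial R] {C : ModuleCat.{u} R}
    (h : IsSemidualizing C) [Module.Free R C] : Nonempty (C ≃ₗ[R] R) := by
  have := h.finite
  have h1 : Module.finrank R (C →ₗ[R] C) = 1 := by
    rw [← (LinearEquiv.ofBijective _ h.homothety_bijective).finrank_eq, Module.finrank_self]
  rw [Module.finrank_linearMap] at h1
  have h2 : Module.finrank R C = 1 := Nat.eq_one_of_mul_eq_one_left h1
  exact ⟨LinearEquiv.ofFinrankEq _ _ (by rw [h2, Module.finrank_self])⟩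

/-- The biduality isomorphism of a totally `C`-reflexive module. -/
noncomputable abbrev IsTotallyReflexive.biduality {C M : ModuleCat.{u} R}
    (h : IsTotallyReflexive C M) : M ≃ₗ[R] dagger C (dagger C M) :=
  LinearEquiv.ofBijective _ h.biduality_bijective

theorem finite_dagger [IsNoetherianRing R] (C M : ModuleCat.{u} R) [Module.Finite R C]
    [Module.Finite R M] : Module.Finite R (dagger C M) := by
  obtain ⟨n, g, hg⟩ := Module.Finite.exists_fin' R M
  exact Module.Finite.of_injective (LinearMap.lcomp R C g) fun φ ψ h => by
    ext x
    obtain ⟨y, rfl⟩ := hg x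
    exact LinearMap.congr_fun h y

/-- The evaluation map `A ⊗ Hom(A, C) → C`. -/
noncomputable abbrev evalDagger (A C : ModuleCat.{u} R) : A ⊗[R] dagger C A →ₗ[R] C :=
  TensorProduct.lift LinearMap.applyₗ

section Reflexive

variable {A C : ModuleCat.{u} R}

/-- The dual of a totally `C`-reflexive semidualizing module is semidualizing, since
`RHom(Hom(A, C), Hom(A, C)) = RHom(A, A)`. -/
theorem IsSemidualizing.dagger [IsNoetherianRing R] (hA : IsSemidualizing A)
    (hC : IsSemidualizing C) (h : IsTotallyReflexive C A) : IsSemidualizing (dagger C A) where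
  finite := have := hA.finite; have := hC.finite; finite_dagger C A
  homothety_bijective := by
    constructor
    · rw [injective_iff_map_eq_zero]
      intro r hr
      refine hA.eq_zero_of_smul fun a => h.biduality_bijective.1 ?_
      rw [map_zero]
      ext φ
      change φ (r • a) = 0
      rw [map_smul]
      exact LinearMap.congr_fun (LinearMap.congr_fun hr φ) a
    · intro φ
      obtain ⟨r, hr⟩ := hA.exists_smul_eq (h.biduality.symm.toLinearMap ∘ₗ LinearMap.flip φ)
      refine ⟨r, LinearMap.ext₂ fun f a => ?_⟩
      have h1 : LinearMap.flip φ a = h.biduality (r • a) := by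
        rw [← hr a]; simp
      have h2 := LinearMap.congr_fun h1 f
      simp only [LinearMap.flip_apply] at h2
      rw [h2]
      simp
  ext_eq_zero i hi := by
    have := hA.finite
    exact subsingleton_ext_dagger_swap hi h.ext_eq_zero h.ext_dual_eq_zero
      (ExtVanishes.congr hA.ext_eq_zero (LinearEquiv.refl R _) h.biduality i hi)

variable [IsLocalRing R] [IsArtinianRing R]

/-- Both `Hom(C, C)` and `Hom(A ⊗ Hom(A, C), C) = Hom(A, A)` are `R`, generated by the identity and
the evaluation map, respectively. -/
theorem IsTotallyReflexive.evalDagger_bijective (hA : IsSemidualizing A) (hC : IsSemidualizing C)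
    (h : IsTotallyReflexive C A) : Function.Bijective (evalDagger A C) := by
  have := hA.finite
  have := hC.finite
  have := hC.nontrivial
  have := finite_dagger C A
  have hhom : ∀ ψ : A ⊗[R] _root_.dagger C A →ₗ[R] C, ∃ r : R, ψ = r • evalDagger A C := by
    intro ψ
    obtain ⟨r, hr⟩ := hA.exists_smul_eq (h.biduality.symm.toLinearMap ∘ₗ TensorProduct.curry ψ)
    refine ⟨r, TensorProduct.ext' fun a f => ?_⟩
    have h1 : TensorProduct.curry ψ a = h.biduality (r • a) := by
      rw [← hr a]; simp
    simpa using LinearMap.congr_fun h1 f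
  have : Module.Finite R (A ⊗ _root_.dagger C A : ModuleCat.{u} R) :=
    inferInstanceAs (Module.Finite R (A ⊗[R] (A →ₗ[R] C)))
  refine bijective_of_precomp (X := A ⊗ _root_.dagger C A) (hC.ext_eq_zero 1 le_rfl) _ ?_ ?_
  · intro φ hφ
    obtain ⟨r, hr⟩ := hC.exists_smul_eq φ
    have : r = 0 := hA.eq_zero_of_smul fun a => h.biduality_bijective.1 (by
      rw [map_zero]
      ext f
      change f (r • a) = 0
      rw [map_smul, ← hr]
      exact LinearMap.congr_fun hφ (a ⊗ₜ f))
    ext c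
    rw [hr, this, zero_smul, LinearMap.zero_apply]
  · intro ψ
    obtain ⟨r, rfl⟩ := hhom ψ
    exact ⟨r • LinearMap.id, by rfl⟩

/-- If `A` and `C` are semidualizing and `A` is totally `C`-reflexive, then the derived tensor
product of `A` and `Hom(A, C)` is `C`; this is the vanishing of its higher homology. -/
theorem IsTotallyReflexive.torIndependent (hA : IsSemidualizing A) (hC : IsSemidualizing C)
    (h : IsTotallyReflexive C A) : TorIndependent A (dagger C A) := by
  have := hA.finite
  have := hC.finite
  have := hC.nontrivial
  have := finite_dagger C A
  refine TorIndependent.of_extVanishes (C := C)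
    (ExtVanishes.congr hA.ext_eq_zero (LinearEquiv.refl R _) h.biduality) h.ext_dual_eq_zero
    fun i hi => ?_
  exact ExtVanishes.congr hC.ext_eq_zero (N := C)
    (LinearEquiv.ofBijective _ (h.evalDagger_bijective hA hC)).symm (LinearEquiv.refl R _) i
      (by omega)

/-- If `A ⊗ Y ≅ C` then `Y ≅ Hom(A, C)`, as the canonical map `Y → Hom(A, C)` becomes an
isomorphism after tensoring with `A`. -/
theorem IsTotallyReflexive.nonempty_linearEquiv_dagger {Y : ModuleCat.{u} R} [Module.Finite R Y]
    (hA : IsSemidualizing A) (hC : IsSemidualizing C) (h : IsTotallyReflexive C A)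
    (e : A ⊗[R] Y ≃ₗ[R] C) : Nonempty (Y ≃ₗ[R] dagger C A) := by
  have := hA.finite
  have := hC.finite
  have := hA.nontrivial
  have := finite_dagger C A
  let w : Y →ₗ[R] _root_.dagger C A := (TensorProduct.curry e.toLinearMap).flip
  have hev : evalDagger A C ∘ₗ w.lTensor A = e.toLinearMap := TensorProduct.ext' fun a y => rfl
  have hb : Function.Bijective (w.lTensor A) := by
    refine (Function.Bijective.of_comp_iff' (h.evalDagger_bijective hA hC) _).1 ?_
    rw [← LinearMap.coe_comp, hev]
    exact e.bijective
  have hb' : Function.Bijective (w.rTensor A) := by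
    have : ⇑(w.rTensor A) = ⇑(TensorProduct.comm R A (A →ₗ[R] C)) ∘ ⇑(w.lTensor A) ∘
        ⇑(TensorProduct.comm R A Y).symm := by
      rw [← LinearMap.comm_comp_rTensor_comp_comm_eq]
      ext x
      simp
    rw [this]
    exact (LinearEquiv.bijective _).comp (hb.comp (LinearEquiv.bijective _))
  have hsurj : Function.Surjective w := by
    rw [← LinearMap.range_eq_top, ← Submodule.Quotient.subsingleton_iff]
    by_contra hne
    rw [not_subsingleton_iff_nontrivial] at hne
    have := nontrivial_tensorProduct_of_finite (R := R) ((A →ₗ[R] C) ⧸ LinearMap.range w) A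
    refine not_subsingleton (((A →ₗ[R] C) ⧸ LinearMap.range w) ⊗[R] A)
      (subsingleton_of_forall_eq 0 fun x => ?_)
    obtain ⟨y, rfl⟩ := LinearMap.rTensor_surjective A (Submodule.mkQ_surjective _) x
    obtain ⟨z, rfl⟩ := hb'.2 y
    rw [← LinearMap.comp_apply, ← LinearMap.rTensor_comp, LinearMap.range_mkQ_comp]
    simp
  have hinj : Function.Injective w := by
    let K : ModuleCat.{u} R := ModuleCat.of R (LinearMap.ker w)
    have hK : IsShortExact (A := K) (LinearMap.ker w).subtype w :=
      ⟨Subtype.val_injective, LinearMap.exact_subtype_ker_map w, hsurj⟩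
    have hT := IsShortExact.tensor (A₁ := K) (A := _root_.dagger C A) (B := A) hK
      ((h.torIndependent hA hC).symm 1 le_rfl)
    rw [← LinearMap.ker_eq_bot, ← Submodule.subsingleton_iff_eq_bot]
    by_contra hne
    rw [not_subsingleton_iff_nontrivial] at hne
    have := nontrivial_tensorProduct_of_finite (R := R) (LinearMap.ker w) A
    refine not_subsingleton (LinearMap.ker w ⊗[R] A)
      (subsingleton_of_forall_eq 0 fun x => ?_)
    refine hT.injective (hb'.1 ?_)
    rw [map_zero, map_zero]
    exact (hT.exact _).2 ⟨x, rfl⟩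
  exact ⟨LinearEquiv.ofBijective w ⟨hinj, hsurj⟩⟩

end Reflexive

section Tensor

variable [IsLocalRing R] [IsArtinianRing R] {A B C : ModuleCat.{u} R}

/-- The map `B → Hom(A, C)` adjoint to an isomorphism `A ⊗ B ≃ C`. -/
noncomputable abbrev tensorAdjoint (e : A ⊗[R] B ≃ₗ[R] C) : B →ₗ[R] dagger C A :=
  (TensorProduct.curry e.toLinearMap).flip

/-- Both `Hom(B, B)` and `Hom(B, Hom(A, C)) = Hom(C, C)` are `R`, so that `bijective_of_postcomp`
applies. -/
theorem tensorAdjoint_bijective (hB : IsSemidualizing B)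
    (hC : IsSemidualizing C) (e : A ⊗[R] B ≃ₗ[R] C) : Function.Bijective (tensorAdjoint e) := by
  have := hB.finite
  have := hB.nontrivial
  refine bijective_of_postcomp (hB.ext_eq_zero 1 le_rfl) (X := dagger C A) _ ?_ ?_
  · intro φ hφ
    obtain ⟨r, hr⟩ := hB.exists_smul_eq φ
    have h0 : (r • e.toLinearMap : A ⊗[R] B →ₗ[R] C) = 0 := by
      apply TensorProduct.ext'
      intro a b
      have : e (a ⊗ₜ φ b) = 0 := LinearMap.congr_fun (LinearMap.congr_fun hφ b) a
      rwa [hr, TensorProduct.tmul_smul, map_smul] at this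
    have : r = 0 := hC.eq_zero_of_smul fun c => by
      have : r • e (e.symm c) = 0 := LinearMap.congr_fun h0 (e.symm c)
      rwa [e.apply_symm_apply] at this
    ext b
    rw [hr, this, zero_smul, LinearMap.zero_apply]
  · intro ψ
    obtain ⟨r, hr⟩ := hC.exists_smul_eq
      (TensorProduct.lift (LinearMap.flip ψ) ∘ₗ e.symm.toLinearMap)
    refine ⟨r • LinearMap.id, LinearMap.ext₂ fun b a => ?_⟩
    have := hr (e (a ⊗ₜ b))
    simpa using this.symm

/-- With `Hom(A, C) = B`, the higher groups `Ext^i(B ⊗ A, C)` and `Ext^i(B, Hom(A, C))` vanish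
because `C` and `B` are semidualizing; cancelling `B` leaves those of `A`. -/
theorem extVanishes_of_tensor (hA : IsSemidualizing A) (hB : IsSemidualizing B)
    (hC : IsSemidualizing C) (h : TorIndependent A B) (e : A ⊗[R] B ≃ₗ[R] C) :
    ExtVanishes A C := by
  have := hA.finite
  have := hB.finite
  have := hB.nontrivial
  refine ExtVanishes.of_tensor (A := B) h.symm ?_ ?_
  · exact ExtVanishes.congr hC.ext_eq_zero (M' := B ⊗ A)
      (e.symm.trans (TensorProduct.comm R A B)) (LinearEquiv.refl R _)
  · exact ExtVanishes.congr hB.ext_eq_zero (LinearEquiv.refl R _)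
      (LinearEquiv.ofBijective (tensorAdjoint e) (tensorAdjoint_bijective hB hC e))

/-- Tor-independent semidualizing modules with semidualizing tensor product `C` are totally
`C`-reflexive. -/
theorem IsTotallyReflexive.of_tensor (hA : IsSemidualizing A) (hB : IsSemidualizing B)
    (hC : IsSemidualizing C) (h : TorIndependent A B) (e : A ⊗[R] B ≃ₗ[R] C) :
    IsTotallyReflexive C A := by
  let e' : B ⊗[R] A ≃ₗ[R] C := (TensorProduct.comm R B A).trans e
  let η := LinearEquiv.ofBijective _ (tensorAdjoint_bijective hB hC e)
  have := hA.finite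
  refine ⟨hA.finite, ?_, extVanishes_of_tensor hA hB hC h e, ?_⟩
  · have hb := tensorAdjoint_bijective hA hC e'
    have : ⇑(LinearMap.applyₗ : A →ₗ[R] (A →ₗ[R] C) →ₗ[R] C) =
        ⇑(LinearEquiv.arrowCongr η (LinearEquiv.refl R C)) ∘ ⇑(tensorAdjoint e') := by
      funext a
      ext f
      obtain ⟨b, rfl⟩ := η.surjective f
      simp [η, e']
    rw [this]
    exact (LinearEquiv.bijective _).comp hb
  · exact ExtVanishes.congr (extVanishes_of_tensor hB hA hC h.symm e') η (LinearEquiv.refl R _)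

end Tensor

end Semidualizing

/-! ### Tensor products of families of modules -/

section TensorFamilies

theorem nonempty_tensorList_iso_of_perm {𝒞 : Type*} [Category 𝒞] [MonoidalCategory 𝒞]
    [BraidedCategory 𝒞] {L L' : List 𝒞} (h : L.Perm L') :
    Nonempty (tensorList L ≅ tensorList L') := by
  induction h with
  | nil => exact ⟨Iso.refl _⟩
  | cons x _ ih => exact ⟨whiskerLeftIso x ih.some⟩
  | swap x y L =>
    exact ⟨(α_ y x (tensorList L)).symm ≪≫ whiskerRightIso (β_ y x) (tensorList L) ≪≫
      α_ x y (tensorList L)⟩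
  | trans _ _ ih ih' => exact ⟨ih.some ≪≫ ih'.some⟩

theorem nonempty_tensorList_append_iso {𝒞 : Type*} [Category 𝒞] [MonoidalCategory 𝒞]
    (L L' : List 𝒞) : Nonempty (tensorList (L ++ L') ≅ tensorList L ⊗ tensorList L') := by
  induction L with
  | nil => exact ⟨(λ_ _).symm⟩
  | cons x L ih =>
    exact ⟨whiskerLeftIso x ih.some ≪≫ (α_ x (tensorList L) (tensorList L')).symm⟩

variable {R : Type u} [CommRing R] {n : ℕ} (K : Fin n → ModuleCat.{u} R)

/-- `⊗_{i ∈ ∅} K i = R`. -/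
noncomputable abbrev tensorOverEmpty : tensorOver K ∅ ≃ₗ[R] ModuleCat.of R R :=
  (eqToIso (by simp only [tensorOver, Finset.sort_empty]; rfl) :
    tensorOver K ∅ ≅ ModuleCat.of R R).toLinearEquiv

variable {K}

theorem tensorOver_insert_of_lt {i : Fin n} {s : Finset (Fin n)} (h : ∀ j ∈ s, i < j) :
    tensorOver K (insert i s) = K i ⊗ tensorOver K s := by
  rw [tensorOver, Finset.sort_insert _ (fun j hj => (h j hj).le) fun hi => (h i hi).false]
  rfl

theorem nonempty_tensorOver_union {s t : Finset (Fin n)} (h : Disjoint s t) :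
    Nonempty (tensorOver K s ⊗[R] tensorOver K t ≃ₗ[R] tensorOver K (s ∪ t)) := by
  have hp : (s ∪ t).sort (· ≤ ·) |>.Perm (s.sort (· ≤ ·) ++ t.sort (· ≤ ·)) := by
    rw [← Multiset.coe_eq_coe, ← Multiset.coe_add, Finset.sort_eq, Finset.sort_eq, Finset.sort_eq,
      ← Finset.disjUnion_eq_union s t h, Finset.disjUnion_val]
  have hp' := hp.map K
  rw [List.map_append] at hp'
  exact ⟨((nonempty_tensorList_iso_of_perm hp').some ≪≫
    (nonempty_tensorList_append_iso _ _).some).symm.toLinearEquiv⟩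

theorem nonempty_tensorOver_singleton (i : Fin n) : Nonempty (tensorOver K {i} ≃ₗ[R] K i) :=
  ⟨(eqToIso (by simp only [tensorOver, Finset.sort_singleton]; rfl) ≪≫ ρ_ (K i) :
    tensorOver K {i} ≅ K i).toLinearEquiv⟩

theorem nonempty_tensorOver_insert {i : Fin n} {s : Finset (Fin n)} (h : i ∉ s) :
    Nonempty (K i ⊗[R] tensorOver K s ≃ₗ[R] tensorOver K (insert i s)) := by
  obtain ⟨e⟩ := nonempty_tensorOver_singleton (K := K) i
  obtain ⟨e'⟩ := nonempty_tensorOver_union (K := K) (Finset.disjoint_singleton_left.2 h)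
  rw [← Finset.insert_eq] at e'
  exact ⟨(TensorProduct.congr e.symm (LinearEquiv.refl R _)).trans e'⟩

theorem finite_tensorOver (hK : ∀ i, Module.Finite R (K i)) (s : Finset (Fin n)) :
    Module.Finite R (tensorOver K s) := by
  induction s using Finset.induction_on with
  | empty => exact Module.Finite.equiv (M := R) (tensorOverEmpty K).symm
  | insert i s h ih =>
    have := hK i
    exact Module.Finite.equiv (nonempty_tensorOver_insert h).some

theorem nontrivial_tensorOver [IsLocalRing R] (hK : ∀ i, Module.Finite R (K i))
    (hK' : ∀ i, Nontrivial (K i)) (s : Finset (Fin n)) : Nontrivial (tensorOver K s) := by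
  induction s using Finset.induction_on with
  | empty => exact (tensorOverEmpty K).toEquiv.nontrivial
  | insert i s h ih =>
    have := hK i
    have := hK' i
    have := finite_tensorOver hK s
    have := nontrivial_tensorProduct_of_finite (R := R) (K i) (tensorOver K s)
    exact (nonempty_tensorOver_insert h).some.symm.toEquiv.nontrivial

theorem torIndependent_tensorOver_empty (B : ModuleCat.{u} R) :
    TorIndependent (tensorOver K ∅) B := by
  have : Projective (ModuleCat.of R R) := (IsProjective.iff_projective (R := R) R).1 inferInstance
  exact TorIndependent.congr (A := ModuleCat.of R R)
    (fun i hi => subsingleton_ext_of_projective _ _ hi) (tensorOverEmpty K).symm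
    (LinearEquiv.refl R B)

/-- If each `K i` is Tor-independent of all tensor products of later members of the family, then
tensor products over disjoint index sets are Tor-independent. -/
theorem torIndependent_tensorOver_of_disjoint [IsNoetherianRing R]
    (hK : ∀ i, Module.Finite R (K i))
    (h : ∀ i s, (∀ j ∈ s, i < j) → TorIndependent (K i) (tensorOver K s)) {s t : Finset (Fin n)}
    (hst : Disjoint s t) : TorIndependent (tensorOver K s) (tensorOver K t) := by
  obtain ⟨u, hu⟩ : ∃ u, s ∪ t = u := ⟨_, rfl⟩
  induction u using Finset.induction_on_min generalizing s t with
  | empty =>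
    obtain ⟨rfl, rfl⟩ := Finset.union_eq_empty.1 hu
    exact torIndependent_tensorOver_empty _
  | insert a u ha ih =>
    have key : ∀ s t : Finset (Fin n), Disjoint s t → s ∪ t = insert a u → a ∈ s →
        TorIndependent (tensorOver K s) (tensorOver K t) := by
      intro s t hst hu has
      have hau : a ∉ u := fun h => (ha a h).false
      have hat : a ∉ t := Finset.disjoint_left.1 hst has
      have hu' : s.erase a ∪ t = u := by
        rw [← Finset.erase_insert hau, ← hu, Finset.erase_union_distrib,
          Finset.erase_eq_of_notMem hat]
      have hd : Disjoint (s.erase a) t := hst.mono_left (Finset.erase_subset _ _)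
      have := hK a
      obtain ⟨e⟩ := nonempty_tensorOver_insert (K := K) (Finset.notMem_erase a s)
      rw [Finset.insert_erase has] at e
      refine TorIndependent.congr (A := K a ⊗ tensorOver K (s.erase a)) ?_ e (LinearEquiv.refl R _)
      refine (TorIndependent.tensor_left_iff (h a _ fun j hj => ha j ?_) (ih hd hu')).2 ?_
      · exact hu' ▸ Finset.mem_union_left _ hj
      · obtain ⟨e'⟩ := nonempty_tensorOver_union (K := K) hd
        rw [hu'] at e'
        exact TorIndependent.congr (h a u ha) (LinearEquiv.refl R _) e'.symm
    rcases Finset.mem_union.1 (hu ▸ Finset.mem_insert_self a u : a ∈ s ∪ t) with has | hat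
    · exact key s t hst hu has
    · have := finite_tensorOver hK t
      exact (key t s hst.symm (by rw [Finset.union_comm, hu]) hat).symm

/-- The same Tor-independence, from that of the tensor products of earlier members with `K i`. -/
theorem torIndependent_of_forall_lt [IsNoetherianRing R] (hK : ∀ i, Module.Finite R (K i))
    (h : ∀ i s, (∀ j ∈ s, j < i) → TorIndependent (tensorOver K s) (K i)) (i : Fin n)
    (s : Finset (Fin n)) (hs : ∀ j ∈ s, i < j) : TorIndependent (K i) (tensorOver K s) := by
  have := hK i
  induction s using Finset.induction_on_max with
  | empty =>
    have := finite_tensorOver hK ∅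
    exact (torIndependent_tensorOver_empty _).symm
  | insert m s hm ih =>
    have him : i < m := hs m (Finset.mem_insert_self m s)
    have hs' : ∀ j ∈ s, i < j := fun j hj => hs j (Finset.mem_insert_of_mem hj)
    obtain ⟨e⟩ := nonempty_tensorOver_insert (K := K) (fun h => (hm m h).false)
    refine TorIndependent.congr (B := tensorOver K s ⊗ K m) ?_ (LinearEquiv.refl R _)
      ((TensorProduct.comm R (tensorOver K s) (K m)).trans e)
    refine (TorIndependent.tensor_left_iff (ih hs') (h m s hm)).1 ?_
    refine TorIndependent.congr (h m (insert i s) ?_) ?_ (LinearEquiv.refl R _)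
    · simpa [him] using hm
    · exact (nonempty_tensorOver_insert fun h => (hs' i h).false).some.symm

end TensorFamilies

/-! ### From families of modules to suitable chains -/

section Chains

variable {R : Type u} [CommRing R] {n : ℕ}

theorem iteratedDual_insert_of_lt (C : Fin (n + 1) → ModuleCat.{u} R) {i : Fin n}
    {s : Finset (Fin n)} (h : ∀ j ∈ s, j < i) :
    iteratedDual C (insert i s) = dagger (C i.succ) (iteratedDual C s) := by
  have hs : (insert i s).sort (· ≤ ·) = s.sort (· ≤ ·) ++ [i] := by
    refine List.Perm.eq_of_pairwise (le := (· ≤ ·)) (fun a b _ _ => le_antisymm)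
      (Finset.pairwise_sort _ _) ?_ ?_
    · rw [List.pairwise_append]
      refine ⟨Finset.pairwise_sort _ _, List.pairwise_singleton _ _, fun a ha b hb => ?_⟩
      rw [List.mem_singleton.1 hb]
      exact (h a ((Finset.mem_sort _).1 ha)).le
    · rw [← Multiset.coe_eq_coe, ← Multiset.coe_add, Finset.sort_eq, Finset.sort_eq,
        Finset.insert_val_of_notMem fun hi => (h i hi).false, Multiset.coe_singleton, add_comm,
        Multiset.singleton_add]
  rw [iteratedDual, hs, List.foldl_append]
  rfl

theorem iteratedDual_empty (C : Fin (n + 1) → ModuleCat.{u} R) : iteratedDual C ∅ = C 0 := by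
  rw [iteratedDual, Finset.sort_empty]; rfl

/-- The indices in `Fin n` that stand for the integers `1, …, t`. -/
def below (t : Fin (n + 1)) : Finset (Fin n) := Finset.univ.filter fun i => i.castSucc < t

theorem mem_below {t : Fin (n + 1)} {i : Fin n} : i ∈ below t ↔ i.castSucc < t := by simp [below]

theorem below_zero : below (0 : Fin (n + 1)) = ∅ := by
  ext i; simp [mem_below]

theorem below_mono {s t : Fin (n + 1)} (h : s ≤ t) : below s ⊆ below t := fun _ hi =>
  mem_below.2 ((mem_below.1 hi).trans_le h)

theorem below_succ (i : Fin n) : below i.succ = insert i (below i.castSucc) := by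
  ext j
  simp only [mem_below, Finset.mem_insert, Fin.lt_def, Fin.ext_iff, Fin.val_castSucc, Fin.val_succ]
  omega

theorem mem_below_castSucc {i j : Fin n} : j ∈ below i.castSucc ↔ j < i := by
  simp [mem_below]

theorem below_last : below (Fin.last n) = Finset.univ := by
  ext i; simp [mem_below, Fin.castSucc_lt_last]

section TensorChain

variable [IsLocalRing R] [IsArtinianRing R] {K : Fin n → ModuleCat.{u} R}

/-- `K_t = K_s ⊗ K_{t \ s}` is the derived tensor product of semidualizing modules. -/
theorem isTotallyReflexive_tensorOver
    (hK : ∀ s, IsSemidualizing (tensorOver K s))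
    (hT : ∀ s t, Disjoint s t → TorIndependent (tensorOver K s) (tensorOver K t))
    {s t : Finset (Fin n)} (hst : s ⊆ t) :
    IsTotallyReflexive (tensorOver K t) (tensorOver K s) := by
  obtain ⟨e⟩ := nonempty_tensorOver_union (K := K) (Finset.disjoint_sdiff (s := s) (t := t))
  rw [Finset.union_sdiff_of_subset hst] at e
  exact IsTotallyReflexive.of_tensor (hK _) (hK _) (hK _) (hT _ _ Finset.disjoint_sdiff) e

theorem nonempty_dagger_tensorOver
    (hK : ∀ s, IsSemidualizing (tensorOver K s))
    {s t : Finset (Fin n)} (hst : s ⊆ t) :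
    Nonempty (dagger (tensorOver K t) (tensorOver K s) ≃ₗ[R] tensorOver K (t \ s)) := by
  obtain ⟨e⟩ := nonempty_tensorOver_union (K := K) (Finset.disjoint_sdiff (s := s) (t := t))
  rw [Finset.union_sdiff_of_subset hst] at e
  exact ⟨(LinearEquiv.ofBijective _ (tensorAdjoint_bijective (hK _) (hK _) e)).symm⟩

/-- The iterated duals of the chain `C t = K 1 ⊗ ⋯ ⊗ K t` are tensor products of members of the
family, as taking the dual complements the index set in an initial segment. -/
theorem exists_iteratedDual_tensorOver
    (hK : ∀ s, IsSemidualizing (tensorOver K s))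
    (s : Finset (Fin n)) (t : Fin (n + 1))
    (hst : ∀ i ∈ s, i.succ ≤ t) : ∃ r ⊆ below t,
      Nonempty (iteratedDual (fun t => tensorOver K (below t)) s ≃ₗ[R] tensorOver K r) := by
  induction s using Finset.induction_on_max generalizing t with
  | empty =>
    refine ⟨∅, Finset.empty_subset _, ?_⟩
    rw [iteratedDual_empty, below_zero]
    exact ⟨LinearEquiv.refl R _⟩
  | insert i s hi ih =>
    obtain ⟨r, hr, ⟨e⟩⟩ := ih i.castSucc fun j hj => by
      have := hi j hj
      simp only [Fin.lt_def, Fin.le_def, Fin.val_castSucc, Fin.val_succ] at this ⊢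
      omega
    rw [iteratedDual_insert_of_lt _ hi]
    obtain ⟨e'⟩ := nonempty_dagger_tensorOver hK
      (hr.trans (below_mono (Fin.castSucc_lt_succ (i := i)).le))
    exact ⟨below i.succ \ r, Finset.sdiff_subset.trans
      (below_mono (hst i (Finset.mem_insert_self _ _))),
      ⟨(LinearEquiv.arrowCongr e (LinearEquiv.refl R _)).trans e'⟩⟩

/-- If `K_s ≅ K_t` with `s ⊂ t`, then `K_{t \ s} ≅ R`, so that its factors are invertible modules,
which are free over a local ring. -/
theorem isEmpty_iso_tensorOver
    (hK : ∀ s, IsSemidualizing (tensorOver K s))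
    (hfree : ∀ i, ¬ Module.Free R (K i)) {s t : Finset (Fin n)}
    (hst : s ⊂ t) : IsEmpty (tensorOver K s ≅ tensorOver K t) := by
  refine ⟨fun f => ?_⟩
  obtain ⟨e⟩ := nonempty_tensorOver_union (K := K) (Finset.disjoint_sdiff (s := s) (t := t))
  rw [Finset.union_sdiff_of_subset hst.1] at e
  -- `K_{t \ s} ≅ Hom(K_s, K_t) ≅ Hom(K_s, K_s) ≅ R`
  have e₁ := LinearEquiv.ofBijective _
    (tensorAdjoint_bijective (hK _) (hK _) (e.trans f.symm.toLinearEquiv))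
  have e₂ : tensorOver K (t \ s) ≃ₗ[R] R :=
    e₁.trans (LinearEquiv.ofBijective _ (hK s).homothety_bijective).symm
  obtain ⟨i, hi⟩ := Finset.sdiff_nonempty.2 hst.2
  obtain ⟨e₃⟩ := nonempty_tensorOver_insert (K := K) (Finset.notMem_erase i (t \ s))
  rw [Finset.insert_erase hi] at e₃
  have := Module.Invertible.left (e₃.trans e₂)
  have hfin : Module.Finite R (K i) := inferInstance
  exact hfree i Module.free_of_flat_of_isLocalRing

theorem isSuitableChain_tensorOver
    (hK : ∀ s, IsSemidualizing (tensorOver K s))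
    (hT : ∀ s t, Disjoint s t → TorIndependent (tensorOver K s) (tensorOver K t))
    (hfree : ∀ i, ¬ Module.Free R (K i)) :
    IsSuitableChain (fun t : Fin (n + 1) => tensorOver K (below t)) where
  semidualizing _ := hK _
  reflexive i := isTotallyReflexive_tensorOver hK hT
    (below_mono (Fin.castSucc_lt_succ (i := i)).le)
  distinct := by
    have key : ∀ i j : Fin (n + 1), i < j →
        IsEmpty (tensorOver K (below i) ≅ tensorOver K (below j)) := fun i j hij => by
      refine isEmpty_iso_tensorOver hK hfree ⟨below_mono hij.le, fun h => ?_⟩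
      have : i.castPred (Fin.ne_last_of_lt hij) ∈ below i := h (by simpa [mem_below] using hij)
      simp [mem_below] at this
    intro i j hij
    rcases lt_or_gt_of_ne hij with h | h
    · exact key i j h
    · exact ⟨fun f => (key j i h).false f.symm⟩
  zero_iso := by
    rw [below_zero]
    exact ⟨(tensorOverEmpty K).toModuleIso⟩
  suitable s t hst := by
    obtain ⟨r, hr, ⟨e⟩⟩ := exists_iteratedDual_tensorOver hK s t hst
    exact (isTotallyReflexive_tensorOver hK hT hr).congr (LinearEquiv.refl R _) e.symm

end TensorChain

end Chains

/-! ### From suitable chains to families of modules -/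

section SuitableChain

variable {R : Type u} [CommRing R] {n : ℕ} {C : Fin (n + 1) → ModuleCat.{u} R}

/-- The successive quotients `Hom(C_{i-1}, C_i)` of a chain. -/
abbrev chainHom (C : Fin (n + 1) → ModuleCat.{u} R) (i : Fin n) : ModuleCat.{u} R :=
  dagger (C i.succ) (C i.castSucc)

theorem IsSemidualizingChain.isSemidualizing_chainHom [IsNoetherianRing R]
    (h : IsSemidualizingChain C) (i : Fin n) :
    IsSemidualizing (chainHom C i) :=
  (h.semidualizing i.castSucc).dagger (h.semidualizing i.succ) (h.reflexive i)

theorem IsSuitableChain.isSemidualizing_iteratedDual [IsNoetherianRing R]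
    (h : IsSuitableChain C) (s : Finset (Fin n)) :
    IsSemidualizing (iteratedDual C s) := by
  induction s using Finset.induction_on_max with
  | empty => rw [iteratedDual_empty]; exact h.semidualizing 0
  | insert i s hi ih =>
    rw [iteratedDual_insert_of_lt C hi]
    exact ih.dagger (h.semidualizing _) (h.suitable s i.succ fun j hj =>
      Fin.succ_le_succ_iff.2 (hi j hj).le)

theorem succ_le_of_subset_below {s : Finset (Fin n)} {t : Fin (n + 1)} (hs : s ⊆ below t) :
    ∀ i ∈ s, i.succ ≤ t := fun i hi => by
  have := mem_below.1 (hs hi)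
  simp only [Fin.lt_def, Fin.le_def, Fin.val_castSucc, Fin.val_succ] at this ⊢
  omega

theorem IsSuitableChain.isTotallyReflexive_of_subset (h : IsSuitableChain C) {t : Fin (n + 1)}
    {r : Finset (Fin n)} (hr : r ⊆ below t) {M : ModuleCat.{u} R}
    (e : iteratedDual C r ≃ₗ[R] M) : IsTotallyReflexive (C t) M :=
  (h.suitable r t (succ_le_of_subset_below hr)).congr (LinearEquiv.refl R _) e

variable [IsLocalRing R] [IsArtinianRing R]

/-- The evaluation isomorphism `C_{i-1} ⊗ Hom(C_{i-1}, C_i) ≃ C_i`. -/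
noncomputable abbrev IsSemidualizingChain.tensorChainHom (h : IsSemidualizingChain C) (i : Fin n) :
    C i.castSucc ⊗[R] chainHom C i ≃ₗ[R] C i.succ :=
  LinearEquiv.ofBijective _ ((h.reflexive i).evalDagger_bijective (h.semidualizing i.castSucc)
    (h.semidualizing i.succ))

/-- If `Hom(C_{i-1}, C_i) ≅ R`, then `C_{i-1} ≅ C_{i-1} ⊗ Hom(C_{i-1}, C_i) ≅ C_i`. -/
theorem IsSemidualizingChain.not_free_chainHom (h : IsSemidualizingChain C) (i : Fin n) :
    ¬ Module.Free R (chainHom C i) := by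
  intro hf
  obtain ⟨e⟩ := (h.isSemidualizing_chainHom i).nonempty_linearEquiv_of_free
  have e' : C i.castSucc ≃ₗ[R] C i.succ := (TensorProduct.rid R (C i.castSucc)).symm.trans
    ((TensorProduct.congr (LinearEquiv.refl R _) e.symm).trans (h.tensorChainHom i))
  exact (h.distinct _ _ (Fin.castSucc_lt_succ (i := i)).ne).false e'.toModuleIso

/-- For `s ⊆ {1, …, t}` the tensor product of the modules `Hom(C_{i-1}, C_i)` over `s` is an
iterated dual of the chain, and those over `s` and over its complement in `{1, …, t}` are dual
to each other with respect to `C_t`, with tensor product `C_t`. -/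
theorem IsSuitableChain.tensorOver_chainHom (h : IsSuitableChain C) (t : Fin (n + 1)) :
    ∀ s ⊆ below t,
      (∃ r ⊆ below t, Nonempty (iteratedDual C r ≃ₗ[R] tensorOver (chainHom C) s)) ∧
      Nonempty (tensorOver (chainHom C) s ⊗[R] tensorOver (chainHom C) (below t \ s) ≃ₗ[R] C t) ∧
      Nonempty (tensorOver (chainHom C) (below t \ s) ≃ₗ[R]
        dagger (C t) (tensorOver (chainHom C) s)) := by
  have hfin : ∀ i, Module.Finite R (chainHom C i) := fun i =>
    (h.isSemidualizing_chainHom i).finite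
  induction t using Fin.induction with
  | zero =>
    intro s hs
    rw [below_zero] at hs ⊢
    obtain rfl := Finset.subset_empty.1 hs
    let e₀ : tensorOver (chainHom C) ∅ ≃ₗ[R] R := tensorOverEmpty (chainHom C)
    let e₁ : C 0 ≃ₗ[R] R := h.zero_iso.some.toLinearEquiv
    rw [Finset.sdiff_empty]
    refine ⟨⟨∅, Finset.Subset.refl _, ?_⟩, ⟨?_⟩, ⟨?_⟩⟩
    · rw [iteratedDual_empty]
      exact ⟨e₁.trans e₀.symm⟩
    · exact (TensorProduct.congr e₀ e₀).trans ((TensorProduct.lid R R).trans e₁.symm)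
    · exact e₀.trans ((LinearMap.ringLmapEquivSelf R R R).symm.trans
        (LinearEquiv.arrowCongr e₀.symm e₁.symm))
  | succ i ih =>
    have hi : i ∉ below i.castSucc := fun hi => (mem_below_castSucc.1 hi).false
    have hmono : below i.castSucc ⊆ below i.succ :=
      below_mono (Fin.castSucc_lt_succ (i := i)).le
    have key : ∀ s ⊆ below i.castSucc,
        (∃ r ⊆ below i.castSucc, Nonempty (iteratedDual C r ≃ₗ[R] tensorOver (chainHom C) s)) ∧
        Nonempty (tensorOver (chainHom C) s ⊗[R] tensorOver (chainHom C) (below i.succ \ s) ≃ₗ[R]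
          C i.succ) ∧
        Nonempty (tensorOver (chainHom C) (below i.succ \ s) ≃ₗ[R]
          dagger (C i.succ) (tensorOver (chainHom C) s)) := by
      intro s hs
      obtain ⟨⟨r, hr, ⟨er⟩⟩, ⟨e⟩, -⟩ := ih s hs
      have hsd : below i.succ \ s = insert i (below i.castSucc \ s) := by
        rw [below_succ, Finset.insert_sdiff_of_notMem _ fun h => hi (hs h)]
      obtain ⟨e'⟩ := nonempty_tensorOver_insert (K := chainHom C)
        (fun h => hi (Finset.sdiff_subset h) : i ∉ below i.castSucc \ s)
      rw [← hsd] at e'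
      have e₂ : tensorOver (chainHom C) s ⊗[R] tensorOver (chainHom C) (below i.succ \ s) ≃ₗ[R]
          C i.succ :=
        (TensorProduct.congr (LinearEquiv.refl R _)
          (e'.symm.trans (TensorProduct.comm R _ _))).trans
        ((TensorProduct.assoc R _ _ _).symm.trans
          ((TensorProduct.congr e (LinearEquiv.refl R _)).trans (h.tensorChainHom i)))
      have := finite_tensorOver hfin (below i.succ \ s)
      exact ⟨⟨r, hr, ⟨er⟩⟩, ⟨e₂⟩, IsTotallyReflexive.nonempty_linearEquiv_dagger
        ((h.isSemidualizing_iteratedDual r).congr er) (h.semidualizing _)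
        (h.isTotallyReflexive_of_subset (hr.trans hmono) er) e₂⟩
    intro s hs
    by_cases his : i ∈ s
    · have hc : below i.succ \ s ⊆ below i.castSucc := by
        intro j hj
        rw [below_succ, Finset.mem_sdiff, Finset.mem_insert] at hj
        rcases hj with ⟨rfl | hj, hjs⟩
        · exact absurd his hjs
        · exact hj
      obtain ⟨⟨r, hr, ⟨er⟩⟩, ⟨e⟩, ⟨e'⟩⟩ := key _ hc
      rw [sdiff_sdiff_eq_self hs] at e e'
      have hrefl := h.isTotallyReflexive_of_subset (hr.trans hmono) er
      refine ⟨⟨insert i r, ?_, ?_⟩, ⟨(TensorProduct.comm R _ _).trans e⟩,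
        ⟨hrefl.biduality.trans (LinearEquiv.arrowCongr e'.symm (LinearEquiv.refl R _))⟩⟩
      · rw [below_succ]
        exact Finset.insert_subset_insert i hr
      · rw [iteratedDual_insert_of_lt C fun j hj => mem_below_castSucc.1 (hr hj)]
        exact ⟨(LinearEquiv.arrowCongr er (LinearEquiv.refl R _)).trans e'.symm⟩
    · obtain ⟨⟨r, hr, er⟩, e⟩ := key s fun j hj => by
        have := hs hj
        rw [below_succ, Finset.mem_insert] at this
        exact this.resolve_left fun h => his (h ▸ hj)
      exact ⟨⟨r, hr.trans hmono, er⟩, e⟩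

theorem IsSuitableChain.isSemidualizing_tensorOver (h : IsSuitableChain C) (s : Finset (Fin n)) :
    IsSemidualizing (tensorOver (chainHom C) s) := by
  obtain ⟨⟨r, -, ⟨e⟩⟩, -⟩ := h.tensorOver_chainHom (Fin.last n) s (by simp [below_last])
  exact (h.isSemidualizing_iteratedDual r).congr e

/-- With `A` the tensor product over the complement of `s` in `{1, …, i - 1}`, both `A ⊗ K_s =
C_{i-1}` and `C_{i-1} ⊗ K_i = C_i` are derived tensor products, as is `A ⊗ Hom(A, C_i) = C_i`.
Cancelling the factor `A` shows that `K_s` and `K_i` are Tor-independent. -/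
theorem IsSuitableChain.torIndependent_tensorOver_chainHom (h : IsSuitableChain C) (i : Fin n)
    (s : Finset (Fin n)) (hs : ∀ j ∈ s, j < i) :
    TorIndependent (tensorOver (chainHom C) s) (chainHom C i) := by
  have hs' : s ⊆ below i.castSucc := fun j hj => mem_below_castSucc.2 (hs j hj)
  have hi : i ∉ s := fun hi => (hs i hi).false
  let c := below i.castSucc \ s
  have hmono : below i.castSucc ⊆ below i.succ := below_mono (Fin.castSucc_lt_succ (i := i)).le
  have hcs : below i.castSucc \ c = s := sdiff_sdiff_eq_self hs'
  have hcs' : below i.succ \ c = insert i s := by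
    rw [below_succ, Finset.insert_sdiff_of_notMem, hcs]
    exact fun hic => (mem_below_castSucc.1 (Finset.sdiff_subset hic)).false
  have hA := h.isSemidualizing_tensorOver c
  have := hA.finite
  have := hA.nontrivial
  obtain ⟨⟨r, hr, ⟨er⟩⟩, ⟨e₁⟩, ⟨e₂⟩⟩ := h.tensorOver_chainHom i.castSucc c Finset.sdiff_subset
  obtain ⟨-, -, ⟨e₃⟩⟩ := h.tensorOver_chainHom i.succ c (Finset.sdiff_subset.trans hmono)
  rw [hcs] at e₁ e₂
  rw [hcs'] at e₃
  obtain ⟨e₄⟩ := nonempty_tensorOver_insert (K := chainHom C) hi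
  have hAB : TorIndependent (tensorOver (chainHom C) c) (tensorOver (chainHom C) s) :=
    TorIndependent.congr ((h.isTotallyReflexive_of_subset hr er).torIndependent hA
      (h.semidualizing _)) (LinearEquiv.refl R _) e₂.symm
  refine ExtVanishes.of_tensor (A := tensorOver (chainHom C) c) hAB ?_ ?_
  · exact TorIndependent.congr (A' := tensorOver (chainHom C) c ⊗ tensorOver (chainHom C) s)
      ((h.reflexive i).torIndependent (h.semidualizing _) (h.semidualizing _)) e₁.symm
      (LinearEquiv.refl R _)
  · have h₁ : TorIndependent (tensorOver (chainHom C) c)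
        (tensorOver (chainHom C) s ⊗ chainHom C i) :=
      TorIndependent.congr ((h.isTotallyReflexive_of_subset (hr.trans hmono) er).torIndependent hA
        (h.semidualizing _)) (LinearEquiv.refl R _)
        ((e₃.symm.trans e₄.symm).trans (TensorProduct.comm R _ _))
    exact ExtVanishes.congr h₁ (LinearEquiv.refl R _) (daggerCurry _ _ _).symm

end SuitableChain

/-! ### The total tensor product of complexes -/

section TotalComplex

variable {R : Type u} [CommRing R] (P X : ChainComplex (ModuleCat.{u} R) ℕ)

/-- The projection of `(P ⊗ X)_n` to its summand `P_i ⊗ X_j`; it is zero if `i + j ≠ n`. -/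
noncomputable def tensorProj (i j n : ℕ) : (P ⊗ X).X n ⟶ P.X i ⊗ X.X j :=
  HomologicalComplex.mapBifunctorDesc (fun i' j' _ =>
    if hi : i' = i ∧ j' = j then eqToHom (by rw [hi.1, hi.2]; rfl) else 0)

/-- The inclusion of `P_i ⊗ X_j` into `(P ⊗ X)_n`. -/
noncomputable abbrev tensorIncl (i j n : ℕ) (h : i + j = n) : P.X i ⊗ X.X j ⟶ (P ⊗ X).X n :=
  HomologicalComplex.ιTensorObj P X i j n h

variable {P X}

theorem tensorIncl_tensorProj_self {i j n : ℕ} (h : i + j = n) :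
    tensorIncl P X i j n h ≫ tensorProj P X i j n = 𝟙 _ := by
  refine (HomologicalComplex.ι_mapBifunctorDesc _ _ _ _).trans ?_
  rw [dif_pos ⟨rfl, rfl⟩]; rfl

theorem tensorIncl_tensorProj_of_ne {i j i' j' n : ℕ} (h : i + j = n) (hne : ¬ (i = i' ∧ j = j')) :
    tensorIncl P X i j n h ≫ tensorProj P X i' j' n = 0 := by
  refine (HomologicalComplex.ι_mapBifunctorDesc _ _ _ _).trans ?_
  rw [dif_neg hne]

theorem tensor_hom_ext {n : ℕ} {Y : ModuleCat.{u} R} {f g : (P ⊗ X).X n ⟶ Y}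
    (h : ∀ i j (h : i + j = n), tensorIncl P X i j n h ≫ f = tensorIncl P X i j n h ≫ g) :
    f = g :=
  HomologicalComplex.mapBifunctor.hom_ext h

theorem sum_tensorProj_tensorIncl (n : ℕ) :
    ∑ i : Fin (n + 1), tensorProj P X i (n - i) n ≫
      tensorIncl P X i (n - i) n (Nat.add_sub_of_le (Nat.le_of_lt_succ i.2)) = 𝟙 _ := by
  refine tensor_hom_ext fun i j h => ?_
  rw [Preadditive.comp_sum, Finset.sum_eq_single ⟨i, by omega⟩]
  · obtain rfl : j = n - i := by omega
    rw [← Category.assoc]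
    erw [tensorIncl_tensorProj_self]
    simp
  · intro b _ hb
    rw [← Category.assoc, tensorIncl_tensorProj_of_ne h, Limits.zero_comp]
    rintro ⟨h1, -⟩
    exact hb (Fin.ext h1.symm)
  · simp

theorem tensor_ext {n : ℕ} {z : (P ⊗ X).X n}
    (h : ∀ i j, i + j = n → tensorProj P X i j n z = 0) : z = 0 := by
  have := congr(($(sum_tensorProj_tensorIncl (P := P) (X := X) n)).hom z)
  rw [ModuleCat.hom_sum, LinearMap.sum_apply, ModuleCat.hom_id, LinearMap.id_apply] at this
  rw [← this]
  refine Finset.sum_eq_zero fun i _ => ?_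
  rw [ModuleCat.hom_comp, LinearMap.comp_apply, h i (n - i) (by have := i.2; omega), map_zero]

theorem tensorIncl_d (i j n : ℕ) (h : i + j = n + 1) :
    tensorIncl P X i j (n + 1) h ≫ (P ⊗ X).d (n + 1) n =
      HomologicalComplex.mapBifunctor.d₁ P X (curriedTensor _) (.down ℕ) i j n +
      HomologicalComplex.mapBifunctor.d₂ P X (curriedTensor _) (.down ℕ) i j n := by
  refine (congrArg _ (HomologicalComplex.mapBifunctor.d_eq P X (curriedTensor _) (.down ℕ)
    (n + 1) n)).trans ?_
  rw [Preadditive.comp_add, HomologicalComplex.mapBifunctor.ι_D₁,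
    HomologicalComplex.mapBifunctor.ι_D₂]

/-- The components of the differential of `P ⊗ X`. -/
theorem d_tensorProj (i j n : ℕ) (h : i + j = n) :
    (P ⊗ X).d (n + 1) n ≫ tensorProj P X i j n =
      tensorProj P X (i + 1) j (n + 1) ≫ (P.d (i + 1) i ▷ X.X j) +
      (ComplexShape.ε (ComplexShape.down ℕ) i) •
        (tensorProj P X i (j + 1) (n + 1) ≫ (P.X i ◁ X.d (j + 1) j)) := by
  refine tensor_hom_ext fun i' j' h' => ?_
  rw [← Category.assoc, tensorIncl_d, Preadditive.add_comp, Preadditive.comp_add]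
  congr 1
  · rcases i' with _ | k
    · rw [HomologicalComplex.mapBifunctor.d₁_eq_zero _ _ _ _ _ _ _ (by simp), Limits.zero_comp,
        ← Category.assoc, tensorIncl_tensorProj_of_ne h' (by simp), Limits.zero_comp]
    · rw [HomologicalComplex.mapBifunctor.d₁_eq P X (curriedTensor _) (.down ℕ) (i₁ := k + 1)
        (i₁' := k) rfl j' n (show k + j' = n by omega)]
      have h1 : ComplexShape.ε₁ (ComplexShape.down ℕ) (ComplexShape.down ℕ) (ComplexShape.down ℕ)
        (k + 1, j') = 1 := rfl
      rw [h1, one_smul, Category.assoc, ← Category.assoc (tensorIncl _ _ _ _ _ _)]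
      by_cases hk : k = i ∧ j' = j
      · obtain ⟨rfl, rfl⟩ := hk
        rw [tensorIncl_tensorProj_self]
        erw [tensorIncl_tensorProj_self]
        simp
      · rw [tensorIncl_tensorProj_of_ne h' (by simpa using hk)]
        erw [tensorIncl_tensorProj_of_ne _ hk]
        simp
  · rcases j' with _ | k
    · rw [HomologicalComplex.mapBifunctor.d₂_eq_zero _ _ _ _ _ _ _ (by simp), Limits.zero_comp,
        Linear.comp_units_smul, ← Category.assoc,
        tensorIncl_tensorProj_of_ne h' (by simp), Limits.zero_comp, smul_zero]
    · rw [HomologicalComplex.mapBifunctor.d₂_eq P X (curriedTensor _) (.down ℕ) i' (i₂ := k + 1)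
        (i₂' := k) rfl n (show i' + k = n by omega)]
      have h1 : ComplexShape.ε₂ (ComplexShape.down ℕ) (ComplexShape.down ℕ) (ComplexShape.down ℕ)
        (i', k + 1) = ComplexShape.ε (ComplexShape.down ℕ) i' := rfl
      rw [h1, Linear.units_smul_comp, Linear.comp_units_smul, Category.assoc,
        ← Category.assoc (tensorIncl _ _ _ _ _ _)]
      by_cases hk : i' = i ∧ k = j
      · obtain ⟨rfl, rfl⟩ := hk
        rw [tensorIncl_tensorProj_self]
        erw [tensorIncl_tensorProj_self]
        simp
      · rw [tensorIncl_tensorProj_of_ne h' (by simpa using hk)]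
        erw [tensorIncl_tensorProj_of_ne _ hk]
        simp

end TotalComplex

/-! ### Tensoring with a projective resolution -/

section Resolutions

variable {R : Type u} [CommRing R]

/-- The chain complex `X` of projective modules with the augmentation `π : X_0 → M` is a projective
resolution of `M`. -/
structure IsResolution (X : ChainComplex (ModuleCat.{u} R) ℕ) {M : ModuleCat.{u} R}
    (π : X.X 0 →ₗ[R] M) : Prop where
  projective : ∀ n, Projective (X.X n)
  surjective : Function.Surjective π
  exact_zero : Function.Exact (X.d 1 0).hom π
  exact_succ : ∀ n, Function.Exact (X.d (n + 2) (n + 1)).hom (X.d (n + 1) n).hom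

theorem IsResolution.flat {X : ChainComplex (ModuleCat.{u} R) ℕ} {M : ModuleCat.{u} R}
    {π : X.X 0 →ₗ[R] M} (h : IsResolution X π) (n : ℕ) : Module.Flat R (X.X n) := by
  have := h.projective n
  have : Module.Projective R (X.X n) := (IsProjective.iff_projective (R := R) (X.X n)).2 this
  infer_instance

section Total

variable (P X : ChainComplex (ModuleCat.{u} R) ℕ) {A : ModuleCat.{u} R} (π : P.X 0 →ₗ[R] A)

/-- `tensorProj` as a linear map. -/
noncomputable abbrev tensorProjₗ (i j n : ℕ) : (P ⊗ X).X n →ₗ[R] P.X i ⊗[R] X.X j :=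
  (tensorProj P X i j n).hom

/-- `tensorIncl` as a linear map. -/
noncomputable abbrev tensorInclₗ (i j n : ℕ) (h : i + j = n) :
    P.X i ⊗[R] X.X j →ₗ[R] (P ⊗ X).X n :=
  (tensorIncl P X i j n h).hom

/-- The augmentation `(P ⊗ X)_n → A ⊗ X_n` induced by `π : P_0 → A`. -/
noncomputable def tensorAugment (n : ℕ) : (P ⊗ X).X n →ₗ[R] A ⊗[R] X.X n :=
  π.rTensor (X.X n) ∘ₗ tensorProjₗ P X 0 n n

variable {P X}

theorem tensorProjₗ_tensorInclₗ {i j n : ℕ} (h : i + j = n) (x : P.X i ⊗[R] X.X j) :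
    tensorProjₗ P X i j n (tensorInclₗ P X i j n h x) = x :=
  congr(($(tensorIncl_tensorProj_self h)).hom x)

theorem tensorProjₗ_tensorInclₗ_of_ne {i j i' j' n : ℕ} (h : i + j = n) (hne : i ≠ i')
    (x : P.X i ⊗[R] X.X j) : tensorProjₗ P X i' j' n (tensorInclₗ P X i j n h x) = 0 :=
  congr(($(tensorIncl_tensorProj_of_ne h fun h' => hne h'.1)).hom x)

theorem tensorProjₗ_d {i j n : ℕ} (h : i + j = n) (z : (P ⊗ X).X (n + 1)) :
    tensorProjₗ P X i j n (((P ⊗ X).d (n + 1) n).hom z) =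
      (P.d (i + 1) i).hom.rTensor (X.X j) (tensorProjₗ P X (i + 1) j (n + 1) z) +
      (ComplexShape.ε (ComplexShape.down ℕ) i : ℤ) •
        (X.d (j + 1) j).hom.lTensor (P.X i) (tensorProjₗ P X i (j + 1) (n + 1) z) :=
  congr(($(d_tensorProj i j n h)).hom z)

variable {π}

theorem tensorAugment_d (hπ : π ∘ₗ (P.d 1 0).hom = 0) (n : ℕ) (z : (P ⊗ X).X (n + 1)) :
    tensorAugment P X π n (((P ⊗ X).d (n + 1) n).hom z) =
      (X.d (n + 1) n).hom.lTensor A (tensorAugment P X π (n + 1) z) := by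
  have h1 : (ComplexShape.ε (ComplexShape.down ℕ) 0 : ℤ) = 1 := by simp
  rw [tensorAugment, LinearMap.comp_apply, tensorProjₗ_d (zero_add n), map_add, h1, one_smul,
    ← LinearMap.comp_apply, ← LinearMap.rTensor_comp, hπ, LinearMap.rTensor_zero,
    LinearMap.zero_apply, zero_add, tensorAugment, LinearMap.comp_apply, ← LinearMap.comp_apply,
    LinearMap.rTensor_comp_lTensor, ← LinearMap.lTensor_comp_rTensor]
  rfl

theorem tensorAugment_surjective (hπ : Function.Surjective π) (n : ℕ) :
    Function.Surjective (tensorAugment P X π n) := by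
  intro y
  obtain ⟨x, rfl⟩ := LinearMap.rTensor_surjective (X.X n) hπ y
  exact ⟨tensorInclₗ P X 0 n n (zero_add n) x, by
    rw [tensorAugment, LinearMap.comp_apply, tensorProjₗ_tensorInclₗ]⟩

theorem tensorAugment_tensorInclₗ_succ {i j n : ℕ} (h : i + 1 + j = n)
    (x : P.X (i + 1) ⊗[R] X.X j) :
    tensorAugment P X π n (tensorInclₗ P X (i + 1) j n h x) = 0 := by
  rw [tensorAugment, LinearMap.comp_apply, tensorProjₗ_tensorInclₗ_of_ne h (by omega), map_zero]

/-- A cycle in the kernel of the augmentation `P ⊗ X → A ⊗ X` is the boundary of an element of the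
kernel. The rows `P ⊗ X_j → A ⊗ X_j` are exact, so that the components of the cycle in
`P_k ⊗ X_{n-k}` are removed one after the other, for increasing `k`. -/
theorem exists_d_eq_of_tensorAugment_eq_zero (hP : IsResolution P π)
    (hX : ∀ j, Module.Flat R (X.X j)) (m k n : ℕ) (hk : k + m = n + 1) (z : (P ⊗ X).X n)
    (hz : ∀ n', n' + 1 = n → ((P ⊗ X).d n n').hom z = 0) (hε : tensorAugment P X π n z = 0)
    (hzk : ∀ i j, i + j = n → i < k → tensorProjₗ P X i j n z = 0) :
    ∃ w, ((P ⊗ X).d (n + 1) n).hom w = z ∧ tensorAugment P X π (n + 1) w = 0 := by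
  have hπ : π ∘ₗ (P.d 1 0).hom = 0 := hP.exact_zero.linearMap_comp_eq_zero
  induction m generalizing k z with
  | zero =>
    have : z = 0 := tensor_ext fun i j h => hzk i j h (by omega)
    exact ⟨0, by rw [this, map_zero], map_zero _⟩
  | succ m ih =>
    obtain ⟨j, rfl⟩ : ∃ j, n = k + j := ⟨n - k, by omega⟩
    obtain ⟨x, hx⟩ : ∃ x, (P.d (k + 1) k).hom.rTensor (X.X j) x =
        tensorProjₗ P X k j (k + j) z := by
      rcases k with _ | k
      · refine (rTensor_exact (X.X j) hP.exact_zero hP.surjective _).1 ?_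
        have h0 : 0 + j = j := zero_add j
        revert z
        rw [h0]
        intro z _ hε _
        exact hε
      · refine (Module.Flat.rTensor_exact (X.X j) (hP.exact_succ k) _).1 ?_
        have h0 : k + 1 + j = (k + j) + 1 := by omega
        revert z
        rw [h0]
        intro z hz hε hzk
        have h1 := tensorProjₗ_d rfl z
        rwa [hz _ rfl, map_zero, hzk k (j + 1) (by omega) (by omega), map_zero, smul_zero, add_zero,
          eq_comm] at h1
    let w₁ := tensorInclₗ P X (k + 1) j (k + j + 1) (by omega) x
    have hε₁ : tensorAugment P X π (k + j + 1) w₁ = 0 := tensorAugment_tensorInclₗ_succ _ _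
    obtain ⟨w₂, hw₂, hε₂⟩ := ih (k + 1) (by omega) (z - ((P ⊗ X).d (k + j + 1) (k + j)).hom w₁)
      (fun n' hn' => by
        rw [map_sub, hz n' hn', zero_sub, neg_eq_zero, ← LinearMap.comp_apply,
          ← ModuleCat.hom_comp, HomologicalComplex.d_comp_d]
        rfl)
      (by rw [map_sub, hε, tensorAugment_d hπ, hε₁, map_zero, sub_zero])
      (fun i j' hij hi => by
        rw [map_sub, tensorProjₗ_d hij]
        rw [tensorProjₗ_tensorInclₗ_of_ne (i' := i) _ (by omega), map_zero, smul_zero, add_zero]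
        rcases Nat.lt_succ_iff_lt_or_eq.1 hi with hi | rfl
        · rw [hzk i j' hij hi, tensorProjₗ_tensorInclₗ_of_ne _ (by omega), map_zero, sub_zero]
        · obtain rfl : j' = j := by omega
          rw [tensorProjₗ_tensorInclₗ, hx, sub_self])
    exact ⟨w₁ + w₂, by rw [map_add, hw₂]; abel, by rw [map_add, hε₁, hε₂, add_zero]⟩

/-- Injectivity on homology of the augmentation `P ⊗ X → A ⊗ X`. -/
theorem exists_d_eq_iff_tensorAugment (hP : IsResolution P π)
    (hX : ∀ j, Module.Flat R (X.X j)) {n : ℕ} (z : (P ⊗ X).X n)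
    (hz : ∀ n', n' + 1 = n → ((P ⊗ X).d n n').hom z = 0) :
    (∃ w, ((P ⊗ X).d (n + 1) n).hom w = z) ↔
      ∃ y, (X.d (n + 1) n).hom.lTensor A y = tensorAugment P X π n z := by
  have hπ : π ∘ₗ (P.d 1 0).hom = 0 := hP.exact_zero.linearMap_comp_eq_zero
  constructor
  · rintro ⟨w, rfl⟩
    exact ⟨_, (tensorAugment_d hπ n w).symm⟩
  · rintro ⟨y, hy⟩
    obtain ⟨w, rfl⟩ := tensorAugment_surjective (X := X) hP.surjective (n + 1) y
    rw [← tensorAugment_d hπ] at hy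
    obtain ⟨w', hw', -⟩ := exists_d_eq_of_tensorAugment_eq_zero hP hX (n + 1) 0 n (by omega)
      (z - ((P ⊗ X).d (n + 1) n).hom w) (fun n' hn' => by
        rw [map_sub, hz n' hn', zero_sub, neg_eq_zero, ← LinearMap.comp_apply,
          ← ModuleCat.hom_comp, HomologicalComplex.d_comp_d]
        rfl) (by rw [map_sub, hy, sub_self]) (fun i j _ h => absurd h (by omega))
    exact ⟨w' + w, by rw [map_add, hw']; abel⟩

/-- Surjectivity on homology of the augmentation `P ⊗ X → A ⊗ X`. -/
theorem exists_cycle_tensorAugment_eq (hP : IsResolution P π)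
    (hX : ∀ j, Module.Flat R (X.X j)) {n : ℕ} (y : A ⊗[R] X.X n)
    (hy : ∀ n', n' + 1 = n → (X.d n n').hom.lTensor A y = 0) :
    ∃ z, (∀ n', n' + 1 = n → ((P ⊗ X).d n n').hom z = 0) ∧ tensorAugment P X π n z = y := by
  have hπ : π ∘ₗ (P.d 1 0).hom = 0 := hP.exact_zero.linearMap_comp_eq_zero
  obtain ⟨z, rfl⟩ := tensorAugment_surjective (X := X) hP.surjective n y
  rcases n with _ | n
  · exact ⟨z, fun n' hn' => absurd hn' (by omega), rfl⟩
  · obtain ⟨w, hw, hε⟩ := exists_d_eq_of_tensorAugment_eq_zero hP hX (n + 1) 0 n (by omega)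
      (((P ⊗ X).d (n + 1) n).hom z) (fun n' _ => by
        rw [← LinearMap.comp_apply, ← ModuleCat.hom_comp, HomologicalComplex.d_comp_d]
        rfl) (by rw [tensorAugment_d hπ, hy n rfl]) (fun i j _ h => absurd h (by omega))
    refine ⟨z - w, fun n' hn' => ?_, by rw [map_sub, hε, sub_zero]⟩
    obtain rfl : n' = n := by omega
    rw [map_sub, hw, sub_self]

/-- `P ⊗ X` and `A ⊗ X` have the same homology if `P` is a resolution of `A` and the `X_j` are
flat; this is the resulting equivalence between the vanishing of their homology. -/
theorem exact_tensor_iff (hP : IsResolution P π)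
    (hX : ∀ j, Module.Flat R (X.X j)) (n : ℕ) :
    Function.Exact ((P ⊗ X).d (n + 2) (n + 1)).hom ((P ⊗ X).d (n + 1) n).hom ↔
      Function.Exact ((X.d (n + 2) (n + 1)).hom.lTensor A) ((X.d (n + 1) n).hom.lTensor A) := by
  constructor
  · intro h y
    constructor
    · intro hy
      obtain ⟨z, hz, rfl⟩ := exists_cycle_tensorAugment_eq hP hX y
        (fun n' hn' => by obtain rfl : n' = n := by omega
                          exact hy)
      exact (exists_d_eq_iff_tensorAugment hP hX z hz).1 ((h z).1 (hz n rfl))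
    · rintro ⟨x, rfl⟩
      rw [← LinearMap.comp_apply, ← LinearMap.lTensor_comp, ← ModuleCat.hom_comp,
        HomologicalComplex.d_comp_d]
      simp
  · intro h z
    constructor
    · intro hz
      refine (exists_d_eq_iff_tensorAugment hP hX z fun n' hn' => ?_).2 ((h _).1 ?_)
      · obtain rfl : n' = n := by omega
        exact hz
      · rw [← tensorAugment_d hP.exact_zero.linearMap_comp_eq_zero, hz, map_zero]
    · rintro ⟨x, rfl⟩
      rw [← LinearMap.comp_apply, ← ModuleCat.hom_comp, HomologicalComplex.d_comp_d]
      rfl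

/-- The homology of `P ⊗ X` in degree `0` is `A ⊗ M` if that of `X` is `M`. -/
theorem exact_tensorAugment_zero (hP : IsResolution P π)
    (hX : ∀ j, Module.Flat R (X.X j)) {M : ModuleCat.{u} R} {ρ : X.X 0 →ₗ[R] M}
    (hρ : Function.Surjective ρ) (hρ' : Function.Exact (X.d 1 0).hom ρ) :
    Function.Exact ((P ⊗ X).d 1 0).hom (ρ.lTensor A ∘ₗ tensorAugment P X π 0) := by
  intro z
  rw [LinearMap.comp_apply, (lTensor_exact A hρ' hρ) _]
  exact (exists_d_eq_iff_tensorAugment hP hX z fun n' hn' => absurd hn' (by omega)).symm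

end Total

end Resolutions

/-! ### Ext and Tor computed by projective resolutions -/

section ExtOfResolution

variable {R : Type u} [CommRing R]

/-- The start of a resolution factors through the first syzygy `K` of `M`, which is resolved by the
remaining terms. -/
theorem exists_syzygy {X₂ X₁ X₀ M : ModuleCat.{u} R} {d₁ : X₂ →ₗ[R] X₁} {d₀ : X₁ →ₗ[R] X₀}
    {π : X₀ →ₗ[R] M} (hπ : Function.Surjective π) (h₀ : Function.Exact d₀ π)
    (h₁ : Function.Exact d₁ d₀) :
    ∃ (K : ModuleCat.{u} R) (ι : K →ₗ[R] X₀) (d : X₁ →ₗ[R] K), IsShortExact ι π ∧ ι ∘ₗ d = d₀ ∧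
      Function.Surjective d ∧ Function.Exact d₁ d := by
  refine ⟨ModuleCat.of R (LinearMap.ker π), (LinearMap.ker π).subtype,
    LinearMap.codRestrict (LinearMap.ker π) d₀ fun x => (h₀ _).2 ⟨x, rfl⟩,
    ⟨Subtype.val_injective, LinearMap.exact_subtype_ker_map π, hπ⟩, rfl, ?_, fun x => ?_⟩
  · rintro ⟨y, hy⟩
    obtain ⟨x, rfl⟩ := (h₀ y).1 hy
    exact ⟨x, rfl⟩
  · rw [← h₁ x]
    exact ⟨fun h => congrArg Subtype.val h, fun h => Subtype.ext h⟩

theorem exists_comp_eq_of_surjective {U V W N : Type*} [AddCommGroup U] [AddCommGroup V]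
    [AddCommGroup W] [AddCommGroup N] [Module R U] [Module R V] [Module R W] [Module R N]
    {f : U →ₗ[R] V} {g : V →ₗ[R] W} (hg : Function.Surjective g) (hfg : Function.Exact f g)
    (φ : V →ₗ[R] N) (hφ : φ ∘ₗ f = 0) : ∃ θ : W →ₗ[R] N, θ ∘ₗ g = φ := by
  have hle : LinearMap.ker g ≤ LinearMap.ker φ := by
    intro x hx
    obtain ⟨y, rfl⟩ := (hfg x).1 hx
    exact LinearMap.congr_fun hφ y
  refine ⟨(LinearMap.ker g).liftQ φ hle ∘ₗ (g.quotKerEquivOfSurjective hg).symm.toLinearMap, ?_⟩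
  ext x
  have : (g.quotKerEquivOfSurjective hg).symm (g x) = (LinearMap.ker g).mkQ x := by
    rw [LinearEquiv.symm_apply_eq]; rfl
  simp [this]

/-- `Ext^(n+1)(M, N)` is the cohomology of `Hom(X, N)` for a projective resolution `X` of `M`, at
the level of vanishing. -/
theorem subsingleton_ext_succ_iff (N : ModuleCat.{u} R) (n : ℕ) {M : ModuleCat.{u} R}
    (X : ℕ → ModuleCat.{u} R) (d : ∀ n, X (n + 1) →ₗ[R] X n) (π : X 0 →ₗ[R] M)
    (hX : ∀ n, Projective (X n)) (hπ : Function.Surjective π) (h0 : Function.Exact (d 0) π)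
    (hd : ∀ n, Function.Exact (d (n + 1)) (d n)) :
    Subsingleton (Abelian.Ext M N (n + 1)) ↔ ∀ φ : X (n + 1) →ₗ[R] N, φ ∘ₗ d (n + 1) = 0 →
      ∃ ψ : X n →ₗ[R] N, ψ ∘ₗ d n = φ := by
  have := hX 0
  induction n generalizing M X with
  | zero =>
    obtain ⟨K, ι, d', hK, hι, hd', hd'0⟩ := exists_syzygy hπ h0 (hd 0)
    constructor
    · intro h φ hφ
      obtain ⟨θ, rfl⟩ := exists_comp_eq_of_surjective hd' hd'0 φ hφ
      obtain ⟨ψ, rfl⟩ := hK.exists_extend h θ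
      exact ⟨ψ, by rw [LinearMap.comp_assoc, hι]⟩
    · intro h
      refine hK.ext_one_of_extend (fun θ => ?_) (subsingleton_ext_of_projective _ _ le_rfl)
      obtain ⟨ψ, hψ⟩ := h (θ ∘ₗ d') (by
        rw [LinearMap.comp_assoc, hd'0.linearMap_comp_eq_zero, LinearMap.comp_zero])
      refine ⟨ψ, LinearMap.ext fun x => ?_⟩
      obtain ⟨y, rfl⟩ := hd' x
      rw [← hι] at hψ
      exact LinearMap.congr_fun hψ y
  | succ n ih =>
    obtain ⟨K, ι, d', hK, -, hd', hd'0⟩ := exists_syzygy hπ h0 (hd 0)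
    have key := ih (M := K) (fun n => X (n + 1)) (fun n => d (n + 1)) d' (fun n => hX (n + 1)) hd'
      hd'0 (fun n => hd (n + 1)) (hX 1)
    refine Iff.trans ⟨fun h => ?_, fun h => ?_⟩ key
    · exact hK.ext_first (subsingleton_ext_of_projective _ _ (by omega)) h
    · exact hK.ext_third h (subsingleton_ext_of_projective _ _ (by omega))

/-- A complex `U → V → W` is exact if and only if its dual with respect to the injective cogenerator
`charModule R` is. -/
theorem exact_iff_charModule {U V W : Type u} [AddCommGroup U] [AddCommGroup V] [AddCommGroup W]
    [Module R U] [Module R V] [Module R W] {f : U →ₗ[R] V} {g : V →ₗ[R] W} (hfg : g ∘ₗ f = 0) :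
    (∀ φ : V →ₗ[R] charModule R, φ ∘ₗ f = 0 → ∃ ψ : W →ₗ[R] charModule R, ψ ∘ₗ g = φ) ↔
      Function.Exact f g := by
  constructor
  · intro h v
    constructor
    · intro hv
      by_contra hne
      have hne' : (LinearMap.range f).mkQ v ≠ 0 := by
        rw [Submodule.mkQ_apply, Ne, Submodule.Quotient.mk_eq_zero]
        exact hne
      obtain ⟨φ, hφ⟩ := exists_charModule_apply_ne_zero (R := R) hne'
      obtain ⟨ψ, hψ⟩ := h (φ ∘ₗ (LinearMap.range f).mkQ) (by
        rw [LinearMap.comp_assoc, LinearMap.range_mkQ_comp, LinearMap.comp_zero])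
      apply hφ
      have := LinearMap.congr_fun hψ v
      rw [LinearMap.comp_apply, hv, map_zero] at this
      exact this.symm
    · rintro ⟨u, rfl⟩
      exact LinearMap.congr_fun hfg u
  · intro h φ hφ
    have hle : LinearMap.ker g ≤ LinearMap.ker φ := by
      intro x hx
      obtain ⟨y, rfl⟩ := (h x).1 hx
      exact LinearMap.congr_fun hφ y
    let V' : ModuleCat.{u} R := ModuleCat.of R (V ⧸ LinearMap.ker g)
    have hV : IsShortExact (A := V') (B := ModuleCat.of R W)
        (C := ModuleCat.of R (W ⧸ LinearMap.range ((LinearMap.ker g).liftQ g le_rfl)))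
        ((LinearMap.ker g).liftQ g le_rfl)
        (LinearMap.range ((LinearMap.ker g).liftQ g le_rfl)).mkQ :=
      ⟨LinearMap.ker_eq_bot.1 (Submodule.ker_liftQ_eq_bot _ _ _ le_rfl),
        LinearMap.exact_map_mkQ_range _, Submodule.mkQ_surjective _⟩
    obtain ⟨ψ, hψ⟩ := hV.exists_extend (A := V') (B := ModuleCat.of R W)
      (C := ModuleCat.of R (W ⧸ LinearMap.range ((LinearMap.ker g).liftQ g le_rfl)))
      (subsingleton_ext_charModule _ le_rfl) ((LinearMap.ker g).liftQ φ hle)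
    exact ⟨ψ, LinearMap.ext fun v => LinearMap.congr_fun hψ ((LinearMap.ker g).mkQ v)⟩

/-- `TorIndependent M A` means that `A ⊗ X` is exact in positive degrees for a resolution `X` of
`M`, as `Hom(A ⊗ X, J) = Hom(X, Hom(A, J))`. -/
theorem IsResolution.torIndependent_iff_exact_lTensor {X : ChainComplex (ModuleCat.{u} R) ℕ}
    {M : ModuleCat.{u} R} {ρ : X.X 0 →ₗ[R] M} (hX : IsResolution X ρ) (A : ModuleCat.{u} R) :
    TorIndependent M A ↔ ∀ n, Function.Exact ((X.d (n + 2) (n + 1)).hom.lTensor A)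
      ((X.d (n + 1) n).hom.lTensor A) := by
  have key : ∀ n, Subsingleton (Abelian.Ext M (dagger (charModule R) A) (n + 1)) ↔
      Function.Exact ((X.d (n + 2) (n + 1)).hom.lTensor A) ((X.d (n + 1) n).hom.lTensor A) := by
    intro n
    rw [subsingleton_ext_succ_iff _ n (fun n => X.X n) (fun n => (X.d (n + 1) n).hom) ρ
      hX.projective hX.surjective hX.exact_zero hX.exact_succ, ← exact_iff_charModule (by
        rw [← LinearMap.lTensor_comp, ← ModuleCat.hom_comp, HomologicalComplex.d_comp_d]
        simp)]
    constructor
    · intro h φ hφ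
      obtain ⟨ψ, hψ⟩ := h (TensorProduct.curry φ).flip (LinearMap.ext₂ fun x a =>
        LinearMap.congr_fun hφ (a ⊗ₜ x))
      exact ⟨TensorProduct.lift ψ.flip, TensorProduct.ext' fun a x =>
        LinearMap.congr_fun (LinearMap.congr_fun hψ x) a⟩
    · intro h φ hφ
      obtain ⟨ψ, hψ⟩ := h (TensorProduct.lift φ.flip) (TensorProduct.ext' fun a x =>
        LinearMap.congr_fun (LinearMap.congr_fun hφ x) a)
      exact ⟨(TensorProduct.curry ψ).flip, LinearMap.ext₂ fun x a =>
        LinearMap.congr_fun hψ (a ⊗ₜ x)⟩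
  constructor
  · exact fun h n => (key n).1 (h (n + 1) (by omega))
  · intro h i hi
    obtain ⟨n, rfl⟩ := Nat.exists_eq_add_of_le' hi
    exact (key n).2 (h n)

end ExtOfResolution

/-! ### Amplitude of derived tensor products -/

section Amplitude

variable {R : Type u} [CommRing R]

theorem isZero_homology_succ_iff (X : ChainComplex (ModuleCat.{u} R) ℕ) (n : ℕ) :
    Limits.IsZero (X.homology (n + 1)) ↔
      Function.Exact (X.d (n + 2) (n + 1)).hom (X.d (n + 1) n).hom := by
  rw [← HomologicalComplex.exactAt_iff_isZero_homology,
    HomologicalComplex.exactAt_iff' _ (n + 2) (n + 1) n (by simp) (by simp),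
    ShortComplex.ShortExact.moduleCat_exact_iff_function_exact]
  rfl

theorem surjective_of_isZero_homology_zero {X : ChainComplex (ModuleCat.{u} R) ℕ}
    (h : Limits.IsZero (X.homology 0)) : Function.Surjective (X.d 1 0).hom := by
  rw [← HomologicalComplex.exactAt_iff_isZero_homology,
    HomologicalComplex.exactAt_iff' _ 1 0 0 (by simp) (by simp),
    ShortComplex.ShortExact.moduleCat_exact_iff_function_exact] at h
  intro y
  refine (h y).1 ?_
  change (X.d 0 0).hom y = 0
  rw [X.shape 0 0 (by simp)]
  rfl

/-- The homology of `X` in degree `0` is `M ≠ 0`, so that `amp X = 0` if and only if the homology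
vanishes in positive degrees. -/
theorem ampEqZero_iff {X : ChainComplex (ModuleCat.{u} R) ℕ} {M : ModuleCat.{u} R} [Nontrivial M]
    {π : X.X 0 →ₗ[R] M} (hπ : Function.Surjective π) (h0 : Function.Exact (X.d 1 0).hom π) :
    AmpEqZero X ↔
      ∀ n, Function.Exact (X.d (n + 2) (n + 1)).hom (X.d (n + 1) n).hom := by
  have hne : ¬ Limits.IsZero (X.homology 0) := by
    intro h
    obtain ⟨m, hm⟩ := exists_ne (0 : M)
    obtain ⟨x, rfl⟩ := hπ m
    exact hm ((h0 x).2 (surjective_of_isZero_homology_zero h x))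
  constructor
  · rintro ⟨i, hi, hu⟩ n
    rw [← isZero_homology_succ_iff]
    by_contra hn
    exact absurd ((hu _ hn).trans (hu _ hne).symm) (by omega)
  · intro h
    refine ⟨0, hne, fun i hi => ?_⟩
    rcases i with _ | n
    · rfl
    · exact absurd ((isZero_homology_succ_iff X n).2 (h n)) hi

theorem exists_isResolution_projectiveResolution (A : ModuleCat.{u} R) :
    ∃ π : (projectiveResolution A).complex.X 0 →ₗ[R] A,
      IsResolution (projectiveResolution A).complex π := by
  let P := projectiveResolution A
  refine ⟨(P.π.f 0).hom, P.projective, (ModuleCat.epi_iff_surjective (P.π.f 0)).1 inferInstance,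
    ?_, fun n => ?_⟩
  · exact (ShortComplex.ShortExact.moduleCat_exact_iff_function_exact _).1
      (ShortComplex.exact_of_g_is_cokernel (ShortComplex.mk _ _ P.complex_d_comp_π_f_zero)
        P.isColimitCokernelCofork)
  · exact (ShortComplex.ShortExact.moduleCat_exact_iff_function_exact _).1 (P.exact_succ n)

theorem exists_isResolution_tensorUnit :
    ∃ π : (𝟙_ (ChainComplex (ModuleCat.{u} R) ℕ)).X 0 →ₗ[R] ModuleCat.of R R,
      IsResolution (𝟙_ (ChainComplex (ModuleCat.{u} R) ℕ)) π := by
  let e : (𝟙_ (ChainComplex (ModuleCat.{u} R) ℕ)).X 0 ≅ ModuleCat.of R R :=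
    HomologicalComplex.singleObjXSelf (.down ℕ) 0 (𝟙_ (ModuleCat.{u} R))
  have hz : ∀ n, Subsingleton ((𝟙_ (ChainComplex (ModuleCat.{u} R) ℕ)).X (n + 1)) := fun n =>
    ModuleCat.subsingleton_of_isZero
      (HomologicalComplex.isZero_single_obj_X (.down ℕ) 0 (𝟙_ (ModuleCat.{u} R)) (n + 1) (by simp))
  refine ⟨e.hom.hom, fun n => ?_, e.toLinearEquiv.surjective, fun x => ?_, fun n x => ?_⟩
  · rcases n with _ | n
    · have : Projective (ModuleCat.of R R) :=
        (IsProjective.iff_projective (R := R) R).1 inferInstance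
      exact Projective.of_iso e.symm this
    · exact Projective.of_iso (HomologicalComplex.isZero_single_obj_X (.down ℕ) 0
        (𝟙_ (ModuleCat.{u} R)) (n + 1) (by simp)).isoZero.symm inferInstance
  · constructor
    · intro hx
      refine ⟨0, ?_⟩
      rw [map_zero]
      exact (e.toLinearEquiv.injective (hx.trans (map_zero _).symm)).symm
    · rintro ⟨y, rfl⟩
      have := hz 0
      rw [Subsingleton.elim y 0, map_zero, map_zero]
  · have := hz n
    have := hz (n + 1)
    exact ⟨fun _ => ⟨0, Subsingleton.elim _ _⟩, fun _ => by
      rw [Subsingleton.elim x 0, map_zero]⟩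

/-- `(P ⊗ X)_n` is a retract of a finite sum of the projective modules `P_i ⊗ X_j`. -/
theorem projective_tensor_X {P X : ChainComplex (ModuleCat.{u} R) ℕ}
    (hP : ∀ n, Projective (P.X n)) (hX : ∀ n, Projective (X.X n)) (n : ℕ) :
    Projective ((P ⊗ X).X n) := by
  have h : ∀ i j, Projective (P.X i ⊗ X.X j) := fun i j => by
    have := (IsProjective.iff_projective (R := R) (P.X i)).2 (hP i)
    have := (IsProjective.iff_projective (R := R) (X.X j)).2 (hX j)
    exact (IsProjective.iff_projective (R := R) (P.X i ⊗[R] X.X j)).1 inferInstance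
  refine ⟨fun {E Y} f e _ => ?_⟩
  refine ⟨∑ i : Fin (n + 1), tensorProj P X i (n - i) n ≫ Projective.factorThru
    (tensorIncl P X i (n - i) n (Nat.add_sub_of_le (Nat.le_of_lt_succ i.2)) ≫ f) e, ?_⟩
  rw [Preadditive.sum_comp]
  simp_rw [Category.assoc, Projective.factorThru_comp, ← Category.assoc]
  rw [← Preadditive.sum_comp, sum_tensorProj_tensorIncl, Category.id_comp]

theorem IsResolution.tensor {P X : ChainComplex (ModuleCat.{u} R) ℕ} {A M : ModuleCat.{u} R}
    {π : P.X 0 →ₗ[R] A} {ρ : X.X 0 →ₗ[R] M} (hP : IsResolution P π) (hX : IsResolution X ρ)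
    (h : TorIndependent M A) :
    IsResolution (M := A ⊗ M) (P ⊗ X) (ρ.lTensor A ∘ₗ tensorAugment P X π 0) where
  projective := projective_tensor_X hP.projective hX.projective
  surjective := (LinearMap.lTensor_surjective A hX.surjective).comp
    (tensorAugment_surjective hP.surjective 0)
  exact_zero := exact_tensorAugment_zero hP hX.flat hX.surjective hX.exact_zero
  exact_succ n := (exact_tensor_iff hP hX.flat n).2
    ((hX.torIndependent_iff_exact_lTensor A).1 h n)

/-- The homology of `P ⊗ X = A ⊗ᴸ M` is `Tor_n(A, M)`. -/
theorem ampEqZero_tensor_iff {P X : ChainComplex (ModuleCat.{u} R) ℕ} {A M : ModuleCat.{u} R}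
    [Nontrivial (A ⊗[R] M)] {π : P.X 0 →ₗ[R] A} {ρ : X.X 0 →ₗ[R] M} (hP : IsResolution P π)
    (hX : IsResolution X ρ) : AmpEqZero (P ⊗ X) ↔ TorIndependent M A := by
  have : Nontrivial (A ⊗ M : ModuleCat.{u} R) := inferInstanceAs (Nontrivial (A ⊗[R] M))
  rw [hX.torIndependent_iff_exact_lTensor A, ampEqZero_iff (M := A ⊗ M)
    ((LinearMap.lTensor_surjective A hX.surjective).comp (tensorAugment_surjective hP.surjective 0))
    (exact_tensorAugment_zero hP hX.flat hX.surjective hX.exact_zero)]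
  exact forall_congr' (exact_tensor_iff hP hX.flat)

end Amplitude

/-! ### Strong Tor-independence -/

section StrongTorIndependence

variable {R : Type u} [CommRing R] {n : ℕ} {K : Fin n → ModuleCat.{u} R}

theorem derivedTensorOver_insert_of_lt {i : Fin n} {s : Finset (Fin n)} (h : ∀ j ∈ s, i < j) :
    derivedTensorOver K (insert i s) =
      (projectiveResolution (K i)).complex ⊗ derivedTensorOver K s := by
  rw [derivedTensorOver, Finset.sort_insert _ (fun j hj => (h j hj).le) fun hi => (h i hi).false]
  rfl

/-- The derived tensor product is a resolution of the tensor product as long as each new factor is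
Tor-independent of the tensor product of the later ones. -/
theorem exists_isResolution_derivedTensorOver [IsNoetherianRing R]
    (hK : ∀ i, Module.Finite R (K i))
    {s : Finset (Fin n)} (h : ∀ i t, insert i t ⊆ s → (∀ j ∈ t, i < j) →
      TorIndependent (K i) (tensorOver K t)) :
    ∃ π : (derivedTensorOver K s).X 0 →ₗ[R] tensorOver K s,
      IsResolution (derivedTensorOver K s) π := by
  induction s using Finset.induction_on_min with
  | empty =>
    have h1 : derivedTensorOver K ∅ = 𝟙_ (ChainComplex (ModuleCat.{u} R) ℕ) := by
      rw [derivedTensorOver, Finset.sort_empty]; rfl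
    have h2 : tensorOver K ∅ = ModuleCat.of R R := by
      rw [tensorOver, Finset.sort_empty]; rfl
    rw [h1, h2]
    exact exists_isResolution_tensorUnit
  | insert i s hi ih =>
    obtain ⟨ρ, hρ⟩ := ih fun i' t hit => h i' t (hit.trans (Finset.subset_insert i s))
    obtain ⟨π, hπ⟩ := exists_isResolution_projectiveResolution (K i)
    rw [derivedTensorOver_insert_of_lt hi, tensorOver_insert_of_lt hi]
    have := hK i
    exact ⟨_, hπ.tensor hρ (h i s subset_rfl hi).symm⟩

/-- Strong Tor-independence of a family of nonzero finitely generated modules over a local ring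
means that each member is Tor-independent of the tensor products of later members. -/
theorem stronglyTorIndependent_iff [IsLocalRing R] [IsNoetherianRing R]
    (hK : ∀ i, Module.Finite R (K i)) (hK' : ∀ i, Nontrivial (K i)) :
    StronglyTorIndependent K ↔
      ∀ i s, (∀ j ∈ s, i < j) → TorIndependent (K i) (tensorOver K s) := by
  have key : ∀ i s, (∀ j ∈ s, i < j) → (∀ i' t, insert i' t ⊆ s → (∀ j ∈ t, i' < j) →
      TorIndependent (K i') (tensorOver K t)) →
      (AmpEqZero (derivedTensorOver K (insert i s)) ↔ TorIndependent (K i) (tensorOver K s)) := by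
    intro i s hi h
    obtain ⟨ρ, hρ⟩ := exists_isResolution_derivedTensorOver hK h
    obtain ⟨π, hπ⟩ := exists_isResolution_projectiveResolution (K i)
    have := hK i
    have := hK' i
    have := finite_tensorOver hK s
    have := nontrivial_tensorOver hK hK' s
    have := nontrivial_tensorProduct_of_finite (R := R) (K i) (tensorOver K s)
    rw [derivedTensorOver_insert_of_lt hi, ampEqZero_tensor_iff hπ hρ]
    exact ⟨fun h => h.symm, fun h => h.symm⟩
  constructor
  · intro h i s
    induction hs : s.card using Nat.strong_induction_on generalizing i s with
    | _ m ih =>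
    intro hi
    refine (key i s hi fun i' t hit ht => ?_).1 (h _)
    refine ih t.card ?_ i' t rfl ht
    rw [← hs, Nat.lt_iff_add_one_le, ← Finset.card_insert_of_notMem fun h => (ht i' h).false]
    exact Finset.card_le_card hit
  · intro h s
    obtain ⟨π, hπ⟩ := exists_isResolution_derivedTensorOver hK (s := s) fun i t _ => h i t
    have := nontrivial_tensorOver hK hK' s
    exact (ampEqZero_iff hπ.surjective hπ.exact_zero).2 hπ.exact_succ

end StrongTorIndependence

/-! ### Suitable chains and strongly Tor-independent families -/

theorem theorem3p7 (R : Type u) [CommRing R] [IsLocalRing R] [IsArtinianRing R] (n : ℕ) :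
    IsSDFull R n ↔
      (∃ C : Fin (n + 1) → ModuleCat.{u} R, IsSuitableChain C) ∧
        IsLocalRing.maximalIdeal R ^ (n + 1) = ⊥ := by
  constructor
  · rintro ⟨hm, K, hK, hfree, hT, hs⟩
    have hfin : ∀ i, Module.Finite R (K i) := fun i => (hK i).finite
    exact ⟨⟨_, isSuitableChain_tensorOver hs (fun s t hst =>
      torIndependent_tensorOver_of_disjoint hfin
        ((stronglyTorIndependent_iff hfin fun i => (hK i).nontrivial).1 hT) hst) hfree⟩, hm⟩
  · rintro ⟨⟨C, hC⟩, hm⟩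
    have hK := hC.isSemidualizing_chainHom
    have hfin : ∀ i, Module.Finite R (chainHom C i) := fun i => (hK i).finite
    exact ⟨hm, chainHom C, hK, hC.not_free_chainHom,
      (stronglyTorIndependent_iff hfin fun i => (hK i).nontrivial).2
        (torIndependent_of_forall_lt hfin hC.torIndependent_tensorOver_chainHom),
      hC.isSemidualizing_tensorOver⟩
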